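/- Let $n\ge 3$, and let $\lambda=(\lambda_1,\dots,\lambda_n)$ be a strictly decreasing $n$-tuple of non-negative reals. A Gelfand–Tsetlin pattern with top row $\lambda$ is a real triangular array $z=(z_{i,j})_{1\le j\le i\le n}$ with $z_{n,j}=\lambda_j$ for all $j$ and $z_{i+1,j}\ge z_{i,j}\ge z_{i+1,j+1}$ for all $1\le j\le i\le n-1$; let $\mathrm{GT}(\lambda)$ be the set of these. Put $|z_{i,\cdot}|=\sum_{j=1}^{i} z_{i,j}$ and $|z_{0,\cdot}|=0$. For $v\in\mathbb R^n$ let $\mathrm{GT}(\lambda,v)$ be the set of $z\in\mathrm{GT}(\lambda)$ with $|z_{i,\cdot}|-|z_{i-1,\cdot}|=v_i$ for $1\le i\le n$, and let $V_{\lambda,v}$ be its $\frac{(n-1)(n-2)}2$-dimensional Hausdorff measure, normalized to agree with Lebesgue measure. Let $$S_\lambda(x)=\int_{\mathrm{GT}(\lambda)}\exp\Big(\sum_{i=1}^n\big(|z_{i,\cdot}|-|z_{i-1,\cdot}|\big)x_i\Big)\prod_{1\le j\le i\le n-1}dz_{i,j}\qquad(x\in\mathbb R^n).$$ Let $\mathrm{SH}(\lambda)$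 be the convex hull of all permutations of $\lambda$, and let $\mathrm{pSH}(\lambda)\subseteq\mathbb R^{n-1}$ be its projection to the first $n-1$ coordinates, with Lebesgue measure $\mathrm{vol}(\mathrm{pSH}(\lambda))$. Let $\mu\in\mathrm{SH}(\lambda)$ be an $n$-tuple of non-negative reals, and let $x^*\in\mathbb R^n$ be a minimizer over $\mathbb R^n$ of $g_{\lambda,\mu}(x)=\log S_\lambda(x)-x\cdot\mu$. Then: 1. The probability distribution on $\mathrm{SH}(\lambda)$ whose density with respect to $dv_1\cdots dv_{n-1}$ is proportional to $f_{\lambda,x^*}(v)=V_{\lambda,v}\exp(x^*\cdot v)$ is well defined and has mean $\mu$. 2. $$V_{\lambda,\mu}\ \ge\ \frac{\sqrt{(n-1)!}\;S_\lambda(x^*)}{\exp(n+x^*\cdot\mu)\,\mathrm{vol}(\mathrm{pSH}(\lambda))}.$$ -/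

import Mathlib

open MeasureTheory

noncomputable section

namespace KostkaVolume

/-- Positions in a triangular array with `n` rows; the row with (0-based) index `i` has
`i + 1` entries, so it is row number `i + 1` when counted from 1. -/
abbrev TriIdx (n : ℕ) : Type := Σ i : Fin n, Fin ((i : ℕ) + 1)

/-- `x` is a Gelfand-Tsetlin pattern with `n` rows: consecutive rows interlace. -/
def IsGTPattern {n : ℕ} (x : TriIdx n → ℝ) : Prop :=
  ∀ (i : ℕ) (h : i + 1 < n) (j : Fin (i + 1)),
    x ⟨⟨i, Nat.lt_of_succ_lt h⟩, j⟩ ≤ x ⟨⟨i + 1, h⟩, j.castSucc⟩ ∧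
      x ⟨⟨i + 1, h⟩, j.succ⟩ ≤ x ⟨⟨i, Nat.lt_of_succ_lt h⟩, j⟩

/-- The sum of the entries of row number `k`, rows being counted from 1; the sum of row
number 0 is 0. -/
def rowSum {n : ℕ} (x : TriIdx n → ℝ) : ℕ → ℝ
  | 0 => 0
  | k + 1 => if h : k < n then ∑ j : Fin (k + 1), x ⟨⟨k, h⟩, j⟩ else 0

/-- The vector of differences of consecutive row sums. -/
def weight {n : ℕ} (x : TriIdx n → ℝ) (i : Fin n) : ℝ :=
  rowSum x ((i : ℕ) + 1) - rowSum x (i : ℕ)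

/-- `GT(lam)`: the Gelfand-Tsetlin patterns with top row `lam`. -/
def GT {n : ℕ} (lam : Fin n → ℝ) : Set (TriIdx n → ℝ) :=
  {x | IsGTPattern x ∧
    ∀ (i : Fin n) (j : Fin ((i : ℕ) + 1)), (i : ℕ) + 1 = n →
      x ⟨i, j⟩ = lam ⟨j, by have := i.isLt; have := j.isLt; omega⟩}

/-- `GT(lam, mu)`: the patterns with top row `lam` and weight `mu`. -/
def GTw {n : ℕ} (lam mu : Fin n → ℝ) : Set (TriIdx n → ℝ) :=
  {x | x ∈ GT lam ∧ ∀ i, weight x i = mu i}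

/-- The space of the lower `n - 1` rows of a triangular array with `n` rows. -/
abbrev LowerRows (n : ℕ) : Type := EuclideanSpace ℝ (TriIdx (n - 1))

/-- The triangular array with top row `lam` and lower rows `z`. -/
def withTop {n : ℕ} (lam : Fin n → ℝ) (z : LowerRows n) : TriIdx n → ℝ := fun q =>
  if h : (q.1 : ℕ) < n - 1 then z ⟨⟨q.1, h⟩, q.2⟩
  else lam ⟨q.2, by have := q.1.isLt; have := q.2.isLt; omega⟩

/-- `GT(lam)` with the (fixed) top row removed. -/
def pGT {n : ℕ} (lam : Fin n → ℝ) : Set (LowerRows n) :=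
  {z | withTop lam z ∈ GT lam}

/-- `GT(lam, mu)` with the (fixed) top row removed. -/
def pGTw {n : ℕ} (lam mu : Fin n → ℝ) : Set (LowerRows n) :=
  {z | withTop lam z ∈ GTw lam mu}

/-- The volume `V_{lam, mu}` of the Kostka polytope: its `(n-1)(n-2)/2`-dimensional Hausdorff
measure, normalized so that it agrees with Lebesgue measure in Euclidean spaces of that
dimension. -/
def V {n : ℕ} (lam mu : Fin n → ℝ) : ℝ :=
  (Measure.euclideanHausdorffMeasure ((n - 1) * (n - 2) / 2)).real (pGTw lam mu)

/-- The continuous analogue `S_lam(x)` of the Schur polynomials. -/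
def S {n : ℕ} (lam x : Fin n → ℝ) : ℝ :=
  ∫ z in pGT lam, Real.exp (∑ i, weight (withTop lam z) i * x i)

/-- The function `g_{lam, mu}(x) = log S_lam(x) - x · mu`. -/
def g {n : ℕ} (lam mu x : Fin n → ℝ) : ℝ :=
  Real.log (S lam x) - x ⬝ᵥ mu

/-- The Schur-Horn polytope (permutohedron) of `lam`. -/
def SH {n : ℕ} (lam : Fin n → ℝ) : Set (Fin n → ℝ) :=
  convexHull ℝ (Set.range fun σ : Equiv.Perm (Fin n) => fun i => lam (σ i))

/-- The projection to the first `n - 1` coordinates. -/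
def proj {n : ℕ} (v : Fin n → ℝ) : Fin (n - 1) → ℝ :=
  fun j => v (Fin.castLE (Nat.sub_le n 1) j)

/-- The projection of the Schur-Horn polytope to the first `n - 1` coordinates. -/
def pSH {n : ℕ} (lam : Fin n → ℝ) : Set (Fin (n - 1) → ℝ) :=
  proj '' SH lam

/-- The inverse of the projection, `u ↦ (u, |lam| - |u|)`. -/
def lift {n : ℕ} (lam : Fin n → ℝ) (u : Fin (n - 1) → ℝ) : Fin n → ℝ := fun i =>
  if h : (i : ℕ) < n - 1 then u ⟨i, h⟩ else ∑ k, lam k - ∑ j, u j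

lemma measurable_lift {n : ℕ} (lam : Fin n → ℝ) : Measurable (lift lam) := by
  refine measurable_pi_lambda _ fun i => ?_
  unfold lift
  split_ifs <;> fun_prop

/-- The `(n - 1)`-dimensional measure `dv_1 ⋯ dv_{n-1}` on `SH(lam)`. -/
def measureSH {n : ℕ} (lam : Fin n → ℝ) : Measure (Fin n → ℝ) :=
  (volume.restrict (pSH lam)).map (lift lam)

/-- The exponentially tilted volume `f_{lam, w}(v) = V_{lam, v} exp(w · v)`. -/
def f {n : ℕ} (lam w v : Fin n → ℝ) : ℝ :=
  V lam v * Real.exp (w ⬝ᵥ v)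

/-- `mean` is the mean of the probability distribution whose density with respect to `m` is
proportional to `h`. Such a distribution exists and has a mean when `h` is nonnegative and
integrable with positive integral and `v ↦ h(v) v` is integrable, which is part of the
definition. -/
def IsMeanOfDensity {E : Type*} [NormedAddCommGroup E] [NormedSpace ℝ E] [MeasurableSpace E]
    (m : Measure E) (h : E → ℝ) (mean : E) : Prop :=
  (∀ v, 0 ≤ h v) ∧ Integrable h m ∧ 0 < ∫ v, h v ∂m ∧ Integrable (fun v => h v • v) m ∧
    (∫ v, h v ∂m)⁻¹ • (∫ v, h v • v ∂m) = mean

end KostkaVolume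

end

section

open Set Pointwise Topology
open scoped ENNReal

/-! Write $W(u)$ for the volume of the fibre of patterns whose first $n-1$ weights are $u$. In
orthonormal coordinates containing the normalized row sums, the weight map becomes a coordinate
projection up to a triangular change of variables of determinant $1/\sqrt{(n-1)!}$. Hence
$V_{\lambda,v}=W(u)$, and
$\sqrt{(n-1)!}\,S_\lambda(x)e^{-x\cdot\mu}=\int_{\mathrm{pSH}(\lambda)}W(u)\,e^{x\cdot(v-\mu)}\,du$
with $v$ the lift of $u$ (`tilt_integral_eq`). A minimizer of $g$ minimizes these integrals over all
$x$.

Mean: the derivative of the integral at $x^*$ vanishes in each coordinate direction, which says that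
the tilted distribution is centred at $\mu$ (`integral_tilt_mul_sub_eq_zero`).

Lower bound: $W$ is log-concave by Brunn–Minkowski and upper semicontinuous by compactness. For any
$L>W(u_0)$, where $u_0$ is the projection of $\mu$, a hyperplane separating $(u_0,\log L)$ from the
hypograph of $\log W$ gives $W(u)\le L\,e^{\ell(u_0-u)}$ (`exists_exp_majorant`). Tilting by $\ell$
makes the integrand at most $L$, so the minimal integral is at most
$L\,\mathrm{vol}(\mathrm{pSH}(\lambda))$; let $L$ decrease to $W(u_0)$. This argument does not lose
the factor $e^n$ of the stated bound. -/

/-! ### Brunn–Minkowski and Prékopa–Leindler inequalities -/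

/-- One-dimensional Brunn–Minkowski for compact sets. -/
lemma volume_add_le_of_isCompact {A B C : Set ℝ} (hA : IsCompact A) (hB : IsCompact B)
    (hA0 : A.Nonempty) (hB0 : B.Nonempty) (h : ∀ a ∈ A, ∀ b ∈ B, a + b ∈ C) :
    volume A + volume B ≤ volume C := by
  -- With $p=\max A$ and $q=\min B$, the translates $A+q$ and $p+B$ both lie in $C$ and meet only at
  -- $p+q$.
  obtain ⟨p, hpA, hp⟩ := hA.exists_isGreatest hA0
  obtain ⟨q, hqB, hq⟩ := hB.exists_isLeast hB0
  have h1 : volume ((fun x => x + q) '' A) = volume A := by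
    rw [image_add_right, measure_preimage_add_right]
  have h2 : volume ((fun x => p + x) '' B) = volume B := by
    rw [image_add_left, measure_preimage_add]
  have hm : MeasurableSet ((fun x => p + x) '' B) :=
    (hB.image (by fun_prop)).isClosed.measurableSet
  have hd : AEDisjoint volume ((fun x => x + q) '' A) ((fun x => p + x) '' B) := by
    refine measure_mono_null (t := {p + q}) ?_ (by simp)
    rintro _ ⟨⟨a, ha, rfl⟩, b, hb, hab⟩
    have := hp ha
    have := hq hb
    simp only at hab
    simp only [mem_singleton_iff]
    linarith
  rw [← h1, ← h2, ← measure_union₀ hm.nullMeasurableSet hd]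
  refine measure_mono ?_
  rintro _ (⟨a, ha, rfl⟩ | ⟨b, hb, rfl⟩)
  · exact h a ha q hqB
  · exact h p hpA b hb

/-- Inner regularity, with a point of `A` adjoined to each compact set: the compact case needs
nonempty sets to have extreme points. -/
lemma volume_eq_iSup_compact_nonempty {A : Set ℝ} (hA : MeasurableSet A) (hA0 : A.Nonempty) :
    volume A ≤ ⨆ K : {K : Set ℝ // K ⊆ A ∧ IsCompact K ∧ K.Nonempty}, volume K.1 := by
  obtain ⟨a, ha⟩ := hA0
  rw [hA.measure_eq_iSup_isCompact]
  refine iSup_le fun K => iSup_le fun hK => iSup_le fun hc => ?_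
  refine le_trans (measure_mono (subset_union_left (t := {a}))) ?_
  exact le_iSup (fun K : {K : Set ℝ // K ⊆ A ∧ IsCompact K ∧ K.Nonempty} => volume K.1)
    ⟨K ∪ {a}, union_subset hK (by simpa), hc.union isCompact_singleton, ⟨a, by simp⟩⟩

/-- One-dimensional Brunn–Minkowski for measurable sets. -/
lemma volume_add_le_of_measurableSet {A B C : Set ℝ} (hA : MeasurableSet A) (hB : MeasurableSet B)
    (hA0 : A.Nonempty) (hB0 : B.Nonempty) (h : ∀ a ∈ A, ∀ b ∈ B, a + b ∈ C) :
    volume A + volume B ≤ volume C := by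
  obtain ⟨a, ha⟩ := hA0
  obtain ⟨b, hb⟩ := hB0
  refine (add_le_add (volume_eq_iSup_compact_nonempty hA ⟨a, ha⟩)
    (volume_eq_iSup_compact_nonempty hB ⟨b, hb⟩)).trans ?_
  have : Nonempty {K : Set ℝ // K ⊆ A ∧ IsCompact K ∧ K.Nonempty} :=
    ⟨⟨{a}, by simpa, isCompact_singleton, by simp⟩⟩
  have : Nonempty {K : Set ℝ // K ⊆ B ∧ IsCompact K ∧ K.Nonempty} :=
    ⟨⟨{b}, by simpa, isCompact_singleton, by simp⟩⟩
  exact ENNReal.iSup_add_iSup_le fun K K' =>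
    volume_add_le_of_isCompact K.2.2.1 K'.2.2.1 K.2.2.2 K'.2.2.2
      fun x hx y hy => h x (K.2.1 hx) y (K'.2.1 hy)

lemma volume_smul_add_smul_le {A B C : Set ℝ} {t : ℝ} (ht0 : 0 < t) (ht1 : t < 1)
    (hA : MeasurableSet A) (hB : MeasurableSet B)
    (hA0 : A.Nonempty) (hB0 : B.Nonempty) (h : ∀ a ∈ A, ∀ b ∈ B, (1 - t) * a + t * b ∈ C) :
    ENNReal.ofReal (1 - t) * volume A + ENNReal.ofReal t * volume B ≤ volume C := by
  have h1 : volume ((1 - t) • A) = ENNReal.ofReal (1 - t) * volume A := by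
    rw [Measure.addHaar_smul]; simp [abs_of_pos (sub_pos.2 ht1)]
  have h2 : volume (t • B) = ENNReal.ofReal t * volume B := by
    rw [Measure.addHaar_smul]; simp [abs_of_pos ht0]
  rw [← h1, ← h2]
  refine volume_add_le_of_measurableSet (hA.const_smul₀ _) (hB.const_smul₀ _) hA0.smul_set
    hB0.smul_set ?_
  rintro _ ⟨a, ha, rfl⟩ _ ⟨b, hb, rfl⟩
  simpa using h a ha b hb

/-- Layer-cake formula for functions bounded by one. -/
lemma lintegral_eq_layer_of_le_one {f : ℝ → ℝ≥0∞} (hf : Measurable f) (h1 : ∀ x, f x ≤ 1) :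
    ∫⁻ x, f x = ∫⁻ s in Ioo (0 : ℝ) 1, volume {x | ENNReal.ofReal s < f x} := by
  have hfin : ∀ x, f x ≠ ∞ := fun x => ((h1 x).trans_lt ENNReal.one_lt_top).ne
  have e := lintegral_eq_lintegral_meas_lt (volume : Measure ℝ) (f := fun x => (f x).toReal)
    (Filter.Eventually.of_forall fun x => ENNReal.toReal_nonneg) hf.ennreal_toReal.aemeasurable
  simp only [ENNReal.ofReal_toReal (hfin _)] at e
  rw [e, ← Ioo_union_Ici_eq_Ioi (zero_lt_one' ℝ), lintegral_union measurableSet_Ici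
    (by rw [Set.disjoint_left]; intro x hx hx'; exact absurd hx.2 (not_lt.2 hx'))]
  have z : ∫⁻ s in Ici (1 : ℝ), volume {x | s < (f x).toReal} = 0 := by
    rw [setLIntegral_congr_fun (g := fun _ => 0) measurableSet_Ici]
    · simp
    · intro s hs
      have : {x | s < (f x).toReal} = ∅ := by
        ext x
        simp only [mem_ofPred_eq, mem_empty_iff_false, iff_false, not_lt]
        exact (ENNReal.toReal_mono ENNReal.one_ne_top (h1 x)).trans (by simpa using hs)
      simp [this]
  rw [z, add_zero]
  refine setLIntegral_congr_fun measurableSet_Ioo fun s hs => ?_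
  congr 1
  ext x
  simp only [mem_ofPred_eq]
  rw [ENNReal.ofReal_lt_iff_lt_toReal hs.1.le (hfin x)]

/-- Equal suprema make the superlevel sets of `f` and `g` nonempty at every height in $(0,1)$, so
one-dimensional Brunn–Minkowski applies height by height. Truncating `h` at 1 confines its layers to
the same heights. -/
lemma prekopa_leindler_normalized {f g h : ℝ → ℝ≥0∞} {t : ℝ} (ht0 : 0 < t) (ht1 : t < 1)
    (hf : Measurable f) (hg : Measurable g) (hh : Measurable h)
    (hfs : ⨆ x, f x = 1) (hgs : ⨆ x, g x = 1)
    (H : ∀ x y, f x ^ (1 - t) * g y ^ t ≤ h ((1 - t) * x + t * y)) :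
    ENNReal.ofReal (1 - t) * (∫⁻ x, f x) + ENNReal.ofReal t * (∫⁻ x, g x) ≤ ∫⁻ x, h x := by
  have hf1 : ∀ x, f x ≤ 1 := fun x => hfs ▸ le_iSup f x
  have hg1 : ∀ x, g x ≤ 1 := fun x => hgs ▸ le_iSup g x
  have key : ∫⁻ x, min (h x) 1 ≤ ∫⁻ x, h x := lintegral_mono fun x => min_le_left _ _
  refine le_trans ?_ key
  rw [lintegral_eq_layer_of_le_one hf hf1, lintegral_eq_layer_of_le_one hg hg1,
    lintegral_eq_layer_of_le_one (hh.min measurable_const) (fun x => min_le_right _ _),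
    ← lintegral_const_mul' _ _ ENNReal.ofReal_ne_top, ← lintegral_const_mul' _ _ ENNReal.ofReal_ne_top]
  refine (le_lintegral_add _ _).trans ?_
  refine setLIntegral_mono' measurableSet_Ioo fun s hs => ?_
  have hs1 : ENNReal.ofReal s < 1 := by simpa using hs.2
  have hs0 : 0 < ENNReal.ofReal s := by simpa using hs.1
  refine volume_smul_add_smul_le ht0 ht1 (measurableSet_lt measurable_const hf)
    (measurableSet_lt measurable_const hg) ?_ ?_ ?_
  · exact lt_iSup_iff.1 (by rwa [hfs])
  · exact lt_iSup_iff.1 (by rwa [hgs])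
  · intro x hx y hy
    simp only [mem_ofPred_eq] at hx hy ⊢
    refine lt_min (lt_of_lt_of_le ?_ (H x y)) hs1
    calc ENNReal.ofReal s = ENNReal.ofReal s ^ (1 - t) * ENNReal.ofReal s ^ t := by
          rw [← ENNReal.rpow_add _ _ hs0.ne' ENNReal.ofReal_ne_top]; simp
      _ < f x ^ (1 - t) * g y ^ t :=
          ENNReal.mul_lt_mul (ENNReal.rpow_lt_rpow hx (sub_pos.2 ht1))
            (ENNReal.rpow_lt_rpow hy ht0)

lemma ennreal_geom_le_arith {a b : ℝ≥0∞} {t : ℝ} (ht0 : 0 < t) (ht1 : t < 1) :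
    a ^ (1 - t) * b ^ t ≤ ENNReal.ofReal (1 - t) * a + ENNReal.ofReal t * b := by
  have h1 : 0 < 1 - t := sub_pos.2 ht1
  rcases eq_or_ne a ∞ with rfl | ha
  · rw [ENNReal.mul_top (by simpa using h1)]; simp
  rcases eq_or_ne b ∞ with rfl | hb
  · rw [ENNReal.mul_top (by simpa using ht0)]; simp
  lift a to NNReal using ha
  lift b to NNReal using hb
  have := Real.geom_mean_le_arith_mean2_weighted h1.le ht0.le a.2 b.2 (by ring)
  rw [← ENNReal.ofReal_coe_nnreal, ← ENNReal.ofReal_coe_nnreal,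
    ENNReal.ofReal_rpow_of_nonneg a.coe_nonneg h1.le,
    ENNReal.ofReal_rpow_of_nonneg b.coe_nonneg ht0.le,
    ← ENNReal.ofReal_mul (by positivity), ← ENNReal.ofReal_mul h1.le, ← ENNReal.ofReal_mul ht0.le,
    ← ENNReal.ofReal_add (by positivity) (by positivity)]
  exact ENNReal.ofReal_le_ofReal this

/-- Both sides scale alike when `f` and `g` are divided by their suprema; AM–GM then turns the
additive normalized inequality into the multiplicative one. -/
lemma prekopa_leindler_of_bounded {f g h : ℝ → ℝ≥0∞} {t : ℝ} (ht0 : 0 < t) (ht1 : t < 1)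
    (hf : Measurable f) (hg : Measurable g) (hh : Measurable h)
    (hfs : ⨆ x, f x ≠ ∞) (hgs : ⨆ x, g x ≠ ∞)
    (H : ∀ x y, f x ^ (1 - t) * g y ^ t ≤ h ((1 - t) * x + t * y)) :
    (∫⁻ x, f x) ^ (1 - t) * (∫⁻ x, g x) ^ t ≤ ∫⁻ x, h x := by
  have h1 : 0 < 1 - t := sub_pos.2 ht1
  set a := ⨆ x, f x with ha
  set b := ⨆ x, g x with hb
  rcases eq_or_ne a 0 with h0 | ha0
  · have : ∀ x, f x = 0 := by simpa [h0, eq_comm] using ha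
    simp [this, h1]
  rcases eq_or_ne b 0 with h0 | hb0
  · have : ∀ x, g x = 0 := by simpa [h0, eq_comm] using hb
    simp [this, ht0]
  have e : ∀ (c : ℝ≥0∞), c ≠ 0 → c ≠ ∞ → ∀ u : ℝ≥0∞, ∀ r : ℝ, 0 < r →
      (c⁻¹ * u) ^ r = (c ^ r)⁻¹ * u ^ r := fun c _ _ u r hr => by
    rw [ENNReal.mul_rpow_of_nonneg _ _ hr.le, ENNReal.inv_rpow]
  have hA0 : a ^ (1 - t) ≠ 0 := by simp [ENNReal.rpow_eq_zero_iff, ha0, hfs]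
  have hB0 : b ^ t ≠ 0 := by simp [ENNReal.rpow_eq_zero_iff, hb0, hgs]
  have hAt : a ^ (1 - t) ≠ ∞ := ENNReal.rpow_ne_top_of_nonneg h1.le hfs
  have hBt : b ^ t ≠ ∞ := ENNReal.rpow_ne_top_of_nonneg ht0.le hgs
  have P := prekopa_leindler_normalized (f := fun x => a⁻¹ * f x) (g := fun x => b⁻¹ * g x)
    (h := fun x => ((a ^ (1 - t))⁻¹ * (b ^ t)⁻¹) * h x) ht0 ht1
    (hf.const_mul _) (hg.const_mul _) (hh.const_mul _)
    (by rw [← ENNReal.mul_iSup, ← ha, ENNReal.inv_mul_cancel ha0 hfs])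
    (by rw [← ENNReal.mul_iSup, ← hb, ENNReal.inv_mul_cancel hb0 hgs])
    (fun x y => by
      rw [e a ha0 hfs _ _ h1, e b hb0 hgs _ _ ht0, mul_mul_mul_comm]
      gcongr
      exact H x y)
  have Q := (ennreal_geom_le_arith ht0 ht1).trans P
  rw [lintegral_const_mul _ hf, lintegral_const_mul _ hg, lintegral_const_mul _ hh,
    e a ha0 hfs _ _ h1, e b hb0 hgs _ _ ht0, mul_mul_mul_comm,
    ← ENNReal.mul_inv (Or.inl hA0) (Or.inl hAt)] at Q
  exact (ENNReal.mul_le_mul_iff_right (by simp [ENNReal.mul_eq_top, hA0, hB0, hAt, hBt])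
    (by simp [hA0, hB0])).1 Q

lemma lintegral_eq_iSup_min {f : ℝ → ℝ≥0∞} (hf : Measurable f) :
    ∫⁻ x, f x = ⨆ n : ℕ, ∫⁻ x, min (f x) n := by
  rw [← lintegral_iSup (fun n => hf.min measurable_const)]
  · refine lintegral_congr fun x => ?_
    rw [← inf_iSup_eq, ENNReal.iSup_natCast]; simp
  · intro m n hmn x
    simp only
    gcongr

/-- The Prékopa–Leindler inequality on the real line. -/
lemma prekopa_leindler_real {f g h : ℝ → ℝ≥0∞} {t : ℝ} (ht0 : 0 < t) (ht1 : t < 1)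
    (hf : Measurable f) (hg : Measurable g) (hh : Measurable h)
    (H : ∀ x y, f x ^ (1 - t) * g y ^ t ≤ h ((1 - t) * x + t * y)) :
    (∫⁻ x, f x) ^ (1 - t) * (∫⁻ x, g x) ^ t ≤ ∫⁻ x, h x := by
  have h1 : 0 < 1 - t := sub_pos.2 ht1
  -- The integrals are suprema over truncations $\min(f,m)$, $\min(g,n)$, which reduces to the
  -- bounded case.
  refine ENNReal.mul_le_of_forall_lt fun a ha b hb => ?_
  rw [← ENNReal.rpow_inv_lt_iff h1, lintegral_eq_iSup_min hf] at ha
  rw [← ENNReal.rpow_inv_lt_iff ht0, lintegral_eq_iSup_min hg] at hb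
  obtain ⟨m, hm⟩ := lt_iSup_iff.1 ha
  obtain ⟨n, hn⟩ := lt_iSup_iff.1 hb
  rw [ENNReal.rpow_inv_lt_iff h1] at hm
  rw [ENNReal.rpow_inv_lt_iff ht0] at hn
  refine (mul_le_mul' hm.le hn.le).trans ?_
  refine prekopa_leindler_of_bounded ht0 ht1 (hf.min measurable_const) (hg.min measurable_const) hh
    ?_ ?_ fun x y => le_trans ?_ (H x y)
  · exact ne_top_of_le_ne_top (ENNReal.natCast_ne_top m) (iSup_le fun x => min_le_right _ _)
  · exact ne_top_of_le_ne_top (ENNReal.natCast_ne_top n) (iSup_le fun x => min_le_right _ _)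
  · gcongr <;> exact min_le_left _ _

lemma lintegral_pi_fin_succ {n : ℕ} {f : (Fin (n + 1) → ℝ) → ℝ≥0∞} (hf : Measurable f) :
    ∫⁻ x, f x = ∫⁻ s : ℝ, ∫⁻ y : Fin n → ℝ, f (Fin.cons s y) := by
  rw [← (volume_preserving_piFinSuccAbove (fun _ : Fin (n + 1) => ℝ) 0).symm.lintegral_comp hf]
  rw [Measure.volume_eq_prod, lintegral_prod _ (by fun_prop)]
  simp [MeasurableEquiv.piFinSuccAbove, Fin.insertNthEquiv]

/-- The Prékopa–Leindler inequality. -/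
theorem prekopa_leindler {n : ℕ} {f g h : (Fin n → ℝ) → ℝ≥0∞} {t : ℝ} (ht0 : 0 < t) (ht1 : t < 1)
    (hf : Measurable f) (hg : Measurable g) (hh : Measurable h)
    (H : ∀ x y, f x ^ (1 - t) * g y ^ t ≤ h ((1 - t) • x + t • y)) :
    (∫⁻ x, f x) ^ (1 - t) * (∫⁻ x, g x) ^ t ≤ ∫⁻ x, h x := by
  induction n with
  | zero =>
    rw [volume_pi, Measure.pi_of_empty _ 0]
    simpa using H 0 0
  | succ n ih =>
    have hc : Measurable fun p : ℝ × (Fin n → ℝ) => (Fin.cons p.1 p.2 : Fin (n + 1) → ℝ) := by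
      refine measurable_pi_lambda _ fun i => ?_
      refine Fin.cases ?_ (fun j => ?_) i <;> simp <;> fun_prop
    have hc' : ∀ s : ℝ, Measurable fun y : Fin n → ℝ => (Fin.cons s y : Fin (n + 1) → ℝ) :=
      fun s => hc.comp (measurable_const.prodMk measurable_id)
    rw [lintegral_pi_fin_succ hf, lintegral_pi_fin_succ hg, lintegral_pi_fin_succ hh]
    -- The integrals over the remaining coordinates satisfy the one-dimensional hypothesis, by
    -- induction.
    refine prekopa_leindler_real ht0 ht1 (hf.comp hc).lintegral_prod_right'
      (hg.comp hc).lintegral_prod_right' (hh.comp hc).lintegral_prod_right' fun s s' => ?_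
    refine ih (hf.comp (hc' s)) (hg.comp (hc' s')) (hh.comp (hc' _)) fun x y => ?_
    refine (H _ _).trans (le_of_eq ?_)
    congr 1
    ext i
    refine Fin.cases ?_ (fun j => ?_) i <;> simp

/-- The multiplicative Brunn–Minkowski inequality. -/
theorem brunn_minkowski_mul {n : ℕ} {A B C : Set (Fin n → ℝ)} {t : ℝ} (ht0 : 0 < t) (ht1 : t < 1)
    (hA : MeasurableSet A) (hB : MeasurableSet B) (hC : MeasurableSet C)
    (H : ∀ a ∈ A, ∀ b ∈ B, (1 - t) • a + t • b ∈ C) :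
    volume A ^ (1 - t) * volume B ^ t ≤ volume C := by
  have P := prekopa_leindler ht0 ht1 (measurable_one.indicator hA) (measurable_one.indicator hB)
    (measurable_one.indicator hC) (fun x y => ?_)
  · simpa [lintegral_indicator_one, hA, hB, hC] using P
  · by_cases hx : x ∈ A
    · by_cases hy : y ∈ B
      · simp [hx, hy, H x hx y hy]
      · simp [hy, ht0]
    · simp [hx, ht1]

/-! ### Exponential majorants and tilts of log-concave functions -/

/-- A bounded log-concave function that is upper semicontinuous at `u₀` is dominated by an
exponential whose value at `u₀` is any prescribed number above `W u₀`. -/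
lemma exists_exp_majorant {E : Type*} [NormedAddCommGroup E] [NormedSpace ℝ E] {W : E → ℝ}
    {u₀ : E} {L M : ℝ} (h0 : ∀ u, 0 ≤ W u) (hM : ∀ u, W u ≤ M)
    (hlc : ∀ u u' : E, ∀ t : ℝ, 0 < t → t < 1 →
      W u ^ (1 - t) * W u' ^ t ≤ W ((1 - t) • u + t • u'))
    (husc : UpperSemicontinuousAt W u₀) (hL : W u₀ < L) :
    ∃ l : E →L[ℝ] ℝ, ∀ u, W u ≤ L * Real.exp (l (u₀ - u)) := by
  have hL0 : 0 < L := (h0 u₀).trans_lt hL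
  by_cases hz : ∀ u, W u ≤ 0
  · exact ⟨0, fun u => (hz u).trans (by positivity)⟩
  push Not at hz
  obtain ⟨u₁, hu₁⟩ := hz
  have hM0 : 0 < M := hu₁.trans_le (hM u₁)
  -- The hypograph of $\log W$, written with `exp` so that points where $W=0$ contribute nothing.
  set A : Set (E × ℝ) := {p | Real.exp p.2 ≤ W p.1} with hA
  have hconv : Convex ℝ A := by
    rintro ⟨u, s⟩ hu ⟨u', s'⟩ hu' a b ha hb hab
    simp only [hA, mem_ofPred_eq] at hu hu' ⊢
    rcases ha.eq_or_lt with rfl | ha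
    · obtain rfl : b = 1 := by linarith
      simpa using hu'
    rcases hb.eq_or_lt with rfl | hb
    · obtain rfl : a = 1 := by linarith
      simpa using hu
    obtain rfl : a = 1 - b := by linarith
    refine le_trans ?_ (hlc u u' b hb (by linarith))
    refine le_trans (le_of_eq ?_) (mul_le_mul (Real.rpow_le_rpow (Real.exp_pos s).le hu ha.le)
      (Real.rpow_le_rpow (Real.exp_pos s').le hu' hb.le) (by positivity)
      (Real.rpow_nonneg (h0 _) _))
    rw [← Real.exp_mul, ← Real.exp_mul, ← Real.exp_add]
    simp [mul_comm]
  have hnot : (u₀, Real.log L) ∉ closure A := by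
    obtain ⟨L', h1, h2⟩ := exists_between hL
    rw [mem_closure_iff_frequently, Filter.not_frequently]
    have e1 : ∀ᶠ p : E × ℝ in 𝓝 (u₀, Real.log L), W p.1 < L' :=
      (continuous_fst.tendsto (u₀, Real.log L)).eventually (husc L' h1)
    have e2 : ∀ᶠ p : E × ℝ in 𝓝 (u₀, Real.log L), L' < Real.exp p.2 := by
      refine ContinuousAt.eventually_lt continuousAt_const (by fun_prop) ?_
      simpa [Real.exp_log hL0] using h2
    filter_upwards [e1, e2] with p h1 h2 h3
    have h4 : Real.exp p.2 ≤ W p.1 := h3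
    linarith
  obtain ⟨φ, r, hφ, hr⟩ := geometric_hahn_banach_closed_point hconv.closure isClosed_closure hnot
  set ψ : E →L[ℝ] ℝ := φ.comp (ContinuousLinearMap.inl ℝ E ℝ) with hψ
  set β := φ (0, 1) with hβ
  have hdec : ∀ u s, φ (u, s) = ψ u + s * β := fun u s => by
    have : (u, s) = (u, (0 : ℝ)) + s • ((0 : E), (1 : ℝ)) := by simp
    rw [this, map_add, map_smul]
    simp [hψ, hβ]
  have hmem : ∀ u s, Real.exp s ≤ W u → ψ u + s * β < r := fun u s h => by
    rw [← hdec]; exact hφ _ (subset_closure h)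
  rw [hdec] at hr
  -- The hypograph is unbounded downwards, which rules out a negative vertical coefficient.
  have hβ0 : 0 ≤ β := by
    by_contra hneg
    push Not at hneg
    set s := min (Real.log (W u₁)) ((r - ψ u₁) / β) with hs
    have h1 := hmem u₁ s (by
      rw [← Real.le_log_iff_exp_le hu₁]; exact min_le_left _ _)
    have h2 : s * β ≥ r - ψ u₁ := by
      have : s ≤ (r - ψ u₁) / β := min_le_right _ _
      rwa [le_div_iff_of_neg hneg] at this
    linarith
  -- If the hyperplane is vertical, $\psi(u_0-u)\ge\delta$ wherever $W(u)>0$, so the slope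
  -- $M/(L\delta)$ lifts the exponential above $M/L$. Otherwise dividing by $\beta$ presents it as
  -- the graph of an affine majorant of $\log W$.
  rcases hβ0.eq_or_lt with hb | hb
  · rw [← hb] at hr
    set δ := ψ u₀ - r with hδ
    have hδ0 : 0 < δ := by simp only [hδ]; linarith
    refine ⟨(M / (L * δ)) • ψ, fun u => ?_⟩
    rcases (h0 u).eq_or_lt with hu | hu
    · rw [← hu]; positivity
    have h1 := hmem u (Real.log (W u)) (by rw [Real.exp_log hu])
    rw [← hb] at h1
    refine (hM u).trans ?_
    have h2 : M / L ≤ Real.exp (((M / (L * δ)) • ψ) (u₀ - u)) := by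
      refine le_trans ?_ (Real.add_one_le_exp _)
      have : δ ≤ ψ (u₀ - u) := by rw [map_sub]; simp only [hδ]; linarith
      have h3 : M / L ≤ M / (L * δ) * ψ (u₀ - u) := by
        calc M / L = M / (L * δ) * δ := by field_simp
          _ ≤ _ := by gcongr
      simp only [FunLike.coe_smul, Pi.smul_apply, smul_eq_mul]
      linarith
    rw [div_le_iff₀ hL0] at h2
    linarith
  · refine ⟨β⁻¹ • ψ, fun u => ?_⟩
    rcases (h0 u).eq_or_lt with hu | hu
    · rw [← hu]; positivity
    have h1 := hmem u (Real.log (W u)) (by rw [Real.exp_log hu])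
    rw [← Real.log_le_log_iff hu (by positivity), Real.log_mul hL0.ne' (Real.exp_pos _).ne',
      Real.log_exp]
    simp only [FunLike.coe_smul, Pi.smul_apply, smul_eq_mul, map_sub]
    have : Real.log (W u) * β ≤ (Real.log L + β⁻¹ * (ψ u₀ - ψ u)) * β := by
      have : β⁻¹ * (ψ u₀ - ψ u) * β = ψ u₀ - ψ u := by field_simp
      rw [add_mul, this]; linarith
    have := le_of_mul_le_mul_right this hb
    linarith

/-- If every exponential tilt of a log-concave `W` around `u₀` has integral at least `I` over a set
of finite volume, then `W u₀` is at least the corresponding average. -/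
lemma le_mul_volume_of_forall_tilt {E : Type*} [NormedAddCommGroup E] [NormedSpace ℝ E]
    [MeasurableSpace E] {m : Measure E} {W : E → ℝ} {P : Set E}
    {u₀ : E} {M I : ℝ} (hP : m P ≠ ∞) (h0 : ∀ u, 0 ≤ W u) (hM : ∀ u, W u ≤ M)
    (hlc : ∀ u u' : E, ∀ t : ℝ, 0 < t → t < 1 →
      W u ^ (1 - t) * W u' ^ t ≤ W ((1 - t) • u + t • u'))
    (husc : UpperSemicontinuousAt W u₀)
    (hI : ∀ l : E →L[ℝ] ℝ, I ≤ ∫ u in P, W u * Real.exp (l (u - u₀)) ∂m) :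
    I ≤ W u₀ * m.real P := by
  have key : ∀ L, W u₀ < L → I ≤ L * m.real P := fun L hL => by
    -- Tilting by this very functional cancels the exponential in the majorant and leaves the
    -- constant `L`.
    obtain ⟨l, hl⟩ := exists_exp_majorant h0 hM hlc husc hL
    refine (hI l).trans ?_
    have : ∫ u in P, W u * Real.exp (l (u - u₀)) ∂m ≤ ∫ u in P, L ∂m := by
      have : IsFiniteMeasure (m.restrict P) := ⟨by simpa using hP.lt_top⟩
      refine integral_mono_of_nonneg (Filter.Eventually.of_forall fun u => ?_)
        (integrable_const _) (Filter.Eventually.of_forall fun u => ?_)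
      · exact mul_nonneg (h0 u) (Real.exp_pos _).le
      · calc W u * Real.exp (l (u - u₀))
            ≤ L * Real.exp (l (u₀ - u)) * Real.exp (l (u - u₀)) := by gcongr; exact hl u
          _ = L := by
            rw [mul_assoc, ← Real.exp_add, ← map_add]; simp
    simpa [mul_comm] using this
  have hc : ContinuousWithinAt (fun L => L * m.real P) (Ioi (W u₀)) (W u₀) := by fun_prop
  exact ge_of_tendsto hc (by filter_upwards [self_mem_nhdsWithin] with L hL using key L hL)

/-- First-order condition for the exponential tilts of a finite measure. -/
lemma integral_mul_eq_zero_of_forall_tilt {α : Type*} [MeasurableSpace α] {m : Measure α}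
    [IsFiniteMeasure m] {φ X : α → ℝ} {C D : ℝ} (hφ : AEStronglyMeasurable φ m)
    (hX : AEStronglyMeasurable X m) (hC : ∀ᵐ z ∂m, |φ z| ≤ C) (hD : ∀ᵐ z ∂m, |X z| ≤ D)
    (h : ∀ t : ℝ, ∫ z, φ z ∂m ≤ ∫ z, φ z * Real.exp (t * X z) ∂m) :
    ∫ z, φ z * X z ∂m = 0 := by
  -- Differentiation under the integral at $t=0$; for $|t|<1$ the derivative is dominated by
  -- $C\,D\,e^D$.
  have hd := hasDerivAt_integral_of_dominated_loc_of_deriv_le (𝕜 := ℝ) (μ := m)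
    (F := fun t z => φ z * Real.exp (t * X z)) (F' := fun t z => φ z * (X z * Real.exp (t * X z)))
    (bound := fun _ => C * (D * Real.exp D)) (x₀ := 0) (s := Metric.ball 0 1)
    (Metric.ball_mem_nhds 0 one_pos)
    (Filter.Eventually.of_forall fun t =>
      hφ.mul (Real.continuous_exp.comp_aestronglyMeasurable (hX.const_mul t)))
    (by simpa using Integrable.of_bound hφ C (by simpa using hC))
    (hφ.mul (hX.mul (Real.continuous_exp.comp_aestronglyMeasurable (hX.const_mul 0))))
    (by
      filter_upwards [hC, hD] with z h1 h2 t ht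
      have ht : |t| < 1 := by simpa using ht
      have hD0 : 0 ≤ D := (abs_nonneg _).trans h2
      have : t * X z ≤ D := by
        refine (le_abs_self _).trans ?_
        rw [abs_mul]
        nlinarith [abs_nonneg (X z), abs_nonneg t]
      rw [Real.norm_eq_abs, abs_mul, abs_mul, Real.abs_exp]
      have := (abs_nonneg _).trans h1
      gcongr)
    (integrable_const _)
    (Filter.Eventually.of_forall fun z t _ => by
      have := (((hasDerivAt_id t).mul_const (X z)).exp.const_mul (φ z))
      simpa [mul_comm] using this)
  have hmin : IsLocalMin (fun t : ℝ => ∫ z, φ z * Real.exp (t * X z) ∂m) 0 :=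
    Filter.Eventually.of_forall fun t => by simpa using h t
  simpa using hmin.hasDerivAt_eq_zero hd.2

/-! ### Weights of patterns lie in the Schur–Horn polytope -/

namespace KostkaVolume

lemma convex_SH {n : ℕ} (a : Fin n → ℝ) : Convex ℝ (SH a) := convex_convexHull _ _

lemma self_comp_mem_SH {n : ℕ} (a : Fin n → ℝ) (σ : Equiv.Perm (Fin n)) : (fun i => a (σ i)) ∈ SH a :=
  subset_convexHull _ _ ⟨σ, rfl⟩

lemma self_mem_SH {n : ℕ} (a : Fin n → ℝ) : a ∈ SH a := self_comp_mem_SH a 1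

lemma comp_mem_SH {n : ℕ} {a v : Fin n → ℝ} (h : v ∈ SH a) (σ : Equiv.Perm (Fin n)) :
    (fun i => v (σ i)) ∈ SH a := by
  have : SH a ⊆ (LinearMap.funLeft ℝ ℝ σ) ⁻¹' SH a := by
    refine convexHull_min ?_ ((convex_SH a).linear_preimage _)
    rintro _ ⟨τ, rfl⟩
    exact self_comp_mem_SH a (σ.trans τ)
  exact this h

lemma SH_subset {n : ℕ} {a b : Fin n → ℝ} (h : b ∈ SH a) : SH b ⊆ SH a := by
  refine convexHull_min ?_ (convex_SH a)
  rintro _ ⟨τ, rfl⟩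
  exact comp_mem_SH h τ

lemma cons_mem_SH {n : ℕ} {b v : Fin n → ℝ} (c : ℝ) (h : v ∈ SH b) :
    (Fin.cons c v : Fin (n + 1) → ℝ) ∈ SH (Fin.cons c b : Fin (n + 1) → ℝ) := by
  have : SH b ⊆ {v | (Fin.cons c v : Fin (n + 1) → ℝ) ∈ SH (Fin.cons c b : Fin (n + 1) → ℝ)} := by
    refine convexHull_min ?_ ?_
    · rintro _ ⟨τ, rfl⟩
      have := self_comp_mem_SH (Fin.cons c b : Fin (n + 1) → ℝ) (Equiv.Perm.decomposeFin.symm (0, τ))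
      simp only [mem_ofPred_eq]
      convert this using 1
      ext i
      refine Fin.cases ?_ (fun j => ?_) i <;> simp
    · intro u hu v hv α β hα hβ hαβ
      have := convex_SH _ hu hv hα hβ hαβ
      simp only [mem_ofPred_eq]
      convert this using 1
      ext i
      refine Fin.cases ?_ (fun j => ?_) i <;> simp [← add_mul, hαβ]
  exact this h

/-- Moving two coordinates towards each other stays in the permutohedron. -/
lemma transfer_mem_SH {n : ℕ} (a : Fin n → ℝ) {i j : Fin n} (hij : i ≠ j) {c : ℝ}
    (h1 : a j ≤ c) (h2 : c ≤ a i) :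
    Function.update (Function.update a i c) j (a i + a j - c) ∈ SH a := by
  have hc : c ∈ segment ℝ (a i) (a j) := by
    rw [segment_symm, segment_eq_Icc (h1.trans h2)]; exact ⟨h1, h2⟩
  obtain ⟨α, β, hα, hβ, hαβ, rfl⟩ := hc
  -- The transferred vector is a convex combination of `a` and `a` with coordinates `i` and `j`
  -- swapped.
  have := convex_SH _ (self_mem_SH a) (self_comp_mem_SH a (Equiv.swap i j)) hα hβ hαβ
  convert this using 1
  obtain rfl : α = 1 - β := by linarith
  ext k
  by_cases hk : k = j
  · subst hk; simp; ring
  · by_cases hk' : k = i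
    · subst hk'; simp [hk]
    · simp [hk, hk', Equiv.swap_apply_of_ne_of_ne]; ring

/-- Lower $a_0$ to $z_0$ and give the excess to $a_1$: this is a transfer, and the new tail,
beginning with $a_0+a_1-z_0\ge a_1$, still interlaces with the tail of $z$. Induct on the length. -/
lemma snoc_mem_SH_of_interlace {k : ℕ} (a : Fin (k + 1) → ℝ) (z : Fin k → ℝ)
    (h1 : ∀ j, z j ≤ a j.castSucc) (h2 : ∀ j, a j.succ ≤ z j) :
    (Fin.snoc z (∑ j, a j - ∑ j, z j) : Fin (k + 1) → ℝ) ∈ SH a := by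
  induction k with
  | zero =>
    convert self_mem_SH a using 1
    ext i
    obtain rfl : i = Fin.last 0 := Fin.ext (by simp)
    simp only [Fin.snoc_last]
    simp
  | succ k ih =>
    set a' : Fin (k + 1) → ℝ := Fin.cons (a 0 + a 1 - z 0) (fun j => a j.succ.succ) with ha'
    have e1 : ∑ j, a j = a 0 + (a 1 + ∑ j : Fin k, a j.succ.succ) := by
      rw [Fin.sum_univ_succ, Fin.sum_univ_succ]; rfl
    have e2 : ∑ j, a' j = a 0 + a 1 - z 0 + ∑ j : Fin k, a j.succ.succ := by
      rw [Fin.sum_univ_succ]; simp [ha']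
    have h10 := h1 0
    have h20 := h2 0
    simp only [Fin.castSucc_zero, Fin.succ_zero_eq_one] at h10 h20
    have hle : ∀ i, a i.succ ≤ a' i := fun i => by
      refine Fin.cases ?_ (fun l => ?_) i
      · simp only [ha', Fin.succ_zero_eq_one, Fin.cons_zero]; linarith
      · simp [ha']
    have I := ih a' (Fin.tail z) (fun j => (h1 j.succ).trans (hle j.castSucc)) (fun j => by
        have := h2 j.succ
        simpa [ha', Fin.tail] using this)
    have h3 := cons_mem_SH (z 0) I
    have h4 : (Fin.cons (z 0) a' : Fin (k + 2) → ℝ) ∈ SH a := by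
      convert transfer_mem_SH a (Fin.zero_ne_one) h20 h10 using 1
      ext i
      refine Fin.cases ?_ (fun j => ?_) i
      · simp
      · refine Fin.cases ?_ (fun l => ?_) j
        · simp [ha']
        · have e : (l.succ.succ : Fin (k + 2)) ≠ 1 := by
            intro h; simpa using congrArg Fin.val h
          simp [ha', e]
    have h5 := SH_subset h4 h3
    rw [Fin.cons_snoc_eq_snoc_cons, Fin.cons_self_tail] at h5
    convert h5 using 2
    rw [e1, e2, Fin.sum_univ_succ z]
    simp [Fin.tail]
    ring

lemma rowSum_succ {n : ℕ} (x : TriIdx n → ℝ) {k : ℕ} (h : k < n) :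
    rowSum x (k + 1) = ∑ j : Fin (k + 1), x ⟨⟨k, h⟩, j⟩ := by
  simp [rowSum, h]

/-- The weights of the first `k + 1` rows of a Gelfand–Tsetlin pattern lie in the permutohedron
of row `k`. -/
lemma weight_mem_SH_row {n : ℕ} {x : TriIdx n → ℝ} (hx : IsGTPattern x) (k : ℕ) (hk : k < n) :
    (fun i : Fin (k + 1) => weight x ⟨i, by omega⟩) ∈ SH (fun j : Fin (k + 1) => x ⟨⟨k, hk⟩, j⟩) := by
  induction k with
  | zero =>
    convert self_mem_SH _ using 1
    ext i
    obtain rfl : i = 0 := Fin.ext (by simp)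
    simp [weight, rowSum, hk]
  | succ k ih =>
    have I := ih (by omega)
    set a : Fin (k + 2) → ℝ := fun j => x ⟨⟨k + 1, hk⟩, j⟩
    set z : Fin (k + 1) → ℝ := fun j => x ⟨⟨k, by omega⟩, j⟩
    have h1 := snoc_mem_SH_of_interlace a z (fun j => (hx k hk j).1) (fun j => (hx k hk j).2)
    set c := ∑ j, a j - ∑ j, z j with hc
    -- Rotating the new entry to the front and back allows `cons_mem_SH` to replace `z` by the
    -- earlier weights.
    have h2 : (Fin.cons c z : Fin (k + 2) → ℝ) ∈ SH a := by
      have := comp_mem_SH h1 (finRotate (k + 2)).symm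
      rw [Fin.snoc_eq_cons_rotate] at this
      simpa using this
    have h3 := comp_mem_SH (SH_subset h2 (cons_mem_SH c I)) (finRotate (k + 2))
    rw [← Fin.snoc_eq_cons_rotate] at h3
    convert h3 using 1
    ext i
    refine Fin.lastCases ?_ (fun j => ?_) i
    · simp [weight, hc, rowSum_succ x hk, rowSum_succ x (show k < n by omega), a, z]
    · simp

lemma weight_mem_SH {n : ℕ} {lam : Fin n → ℝ} {x : TriIdx n → ℝ} (hx : x ∈ GT lam) :
    weight x ∈ SH lam := by
  obtain _ | n := n
  · convert self_mem_SH lam using 1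
  · have := weight_mem_SH_row hx.1 n (Nat.lt_succ_self n)
    convert this using 2
    exact funext fun j => (hx.2 ⟨n, Nat.lt_succ_self n⟩ j rfl).symm

end KostkaVolume

/-! ### Slice volumes of compact convex sets -/

section Slices

variable {α : Type*} {d : ℕ}

/-- The volume of the slice of `F` above `u`. -/
noncomputable def sliceVolume (F : Set (α × (Fin d → ℝ))) (u : α) : ℝ :=
  volume.real (Prod.mk u ⁻¹' F)

lemma sliceVolume_nonneg (F : Set (α × (Fin d → ℝ))) (u : α) : 0 ≤ sliceVolume F u :=
  measureReal_nonneg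

lemma volume_slice_le {F : Set (α × (Fin d → ℝ))} (u : α) :
    volume (Prod.mk u ⁻¹' F) ≤ volume (Prod.snd '' F) :=
  measure_mono fun y hy => ⟨(u, y), hy, rfl⟩

variable [TopologicalSpace α]

lemma volume_slice_ne_top {F : Set (α × (Fin d → ℝ))} (hF : IsCompact F) (u : α) :
    volume (Prod.mk u ⁻¹' F) ≠ ∞ :=
  ((volume_slice_le u).trans_lt (hF.image continuous_snd).measure_lt_top).ne

lemma sliceVolume_le {F : Set (α × (Fin d → ℝ))} (hF : IsCompact F) (u : α) :
    sliceVolume F u ≤ volume.real (Prod.snd '' F) :=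
  ENNReal.toReal_mono (hF.image continuous_snd).measure_lt_top.ne (volume_slice_le u)

/-- Enclose the slice at $u_0$ in an open set $O$ of nearly the same volume. The part of $F$ outside
$O$ projects to a compact set missing $u_0$, so all nearby slices lie in $O$. -/
lemma upperSemicontinuous_sliceVolume [T2Space α] {F : Set (α × (Fin d → ℝ))} (hF : IsCompact F) :
    UpperSemicontinuous (sliceVolume F) := by
  intro u₀ c hc
  have hc0 : 0 ≤ c := (sliceVolume_nonneg F u₀).trans hc.le
  have h1 : volume (Prod.mk u₀ ⁻¹' F) < ENNReal.ofReal c := by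
    rwa [ENNReal.lt_ofReal_iff_toReal_lt (volume_slice_ne_top hF u₀)]
  obtain ⟨O, hO, hOo, hOc⟩ := Set.exists_isOpen_lt_of_lt _ _ h1
  have hK : IsClosed (Prod.fst '' (F ∩ Prod.snd ⁻¹' Oᶜ)) :=
    ((hF.inter_right (hOo.isClosed_compl.preimage continuous_snd)).image continuous_fst).isClosed
  have hu : u₀ ∉ Prod.fst '' (F ∩ Prod.snd ⁻¹' Oᶜ) := by
    rintro ⟨⟨u, y⟩, ⟨h2, h3⟩, rfl⟩
    exact h3 (hO h2)
  filter_upwards [hK.isOpen_compl.mem_nhds hu] with u hu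
  have h2 : volume (Prod.mk u ⁻¹' F) < ENNReal.ofReal c := by
    refine (measure_mono fun y hy => ?_).trans_lt hOc
    by_contra hyO
    exact hu ⟨(u, y), ⟨hy, hyO⟩, rfl⟩
  rwa [ENNReal.lt_ofReal_iff_toReal_lt (volume_slice_ne_top hF u)] at h2

/-- Convexity of `F` puts the combination of two slices inside the intermediate slice;
Brunn–Minkowski does the rest. -/
lemma sliceVolume_logConcave {E : Type*} [NormedAddCommGroup E] [NormedSpace ℝ E]
    {F : Set (E × (Fin d → ℝ))} (hF : IsCompact F)
    (hc : Convex ℝ F) (u u' : E) (t : ℝ) (ht0 : 0 < t) (ht1 : t < 1) :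
    sliceVolume F u ^ (1 - t) * sliceVolume F u' ^ t ≤ sliceVolume F ((1 - t) • u + t • u') := by
  have hm : ∀ u, MeasurableSet (Prod.mk u ⁻¹' F) := fun u =>
    (hF.isClosed.preimage (by fun_prop)).measurableSet
  have h := brunn_minkowski_mul ht0 ht1 (hm u) (hm u') (hm ((1 - t) • u + t • u'))
    (fun a ha b hb => by
      have := hc ha hb (sub_nonneg.2 ht1.le) ht0.le (by ring)
      simpa using this)
  have := ENNReal.toReal_mono (volume_slice_ne_top hF _) h
  rwa [ENNReal.toReal_mul, ← ENNReal.toReal_rpow, ← ENNReal.toReal_rpow] at this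

end Slices

/-! ### Geometry of the Gelfand–Tsetlin polytope -/

namespace KostkaVolume

lemma rowSum_withTop {n : ℕ} (lam : Fin n → ℝ) (z : LowerRows n) {k : ℕ} (hk : k ≤ n - 1) :
    rowSum (withTop lam z) k = rowSum z k := by
  obtain _ | k := k
  · rfl
  · rw [rowSum_succ _ (by omega : k < n), rowSum_succ _ (by omega : k < n - 1)]
    refine Finset.sum_congr rfl fun j _ => ?_
    have : k < n - 1 := by omega
    simp [withTop, this]

lemma rowSum_withTop_top {n : ℕ} (hn : 1 ≤ n) (lam : Fin n → ℝ) (z : LowerRows n) :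
    rowSum (withTop lam z) n = ∑ i, lam i := by
  obtain _ | n := n
  · omega
  · rw [rowSum_succ _ (by omega : n < n + 1)]
    simp [withTop]

lemma sum_weight_lt {m : ℕ} (z : TriIdx m → ℝ) {k : ℕ} (hk : k ≤ m) :
    ∑ i : Fin m, (if (i : ℕ) < k then weight z i else 0) = rowSum z k := by
  have e : ∀ i : Fin m, (if (i : ℕ) < k then weight z i else 0) =
      (fun i : ℕ => if i < k then rowSum z (i + 1) - rowSum z i else 0) i := fun i => rfl
  rw [Finset.sum_congr rfl fun i _ => e i,
    Fin.sum_univ_eq_sum_range (fun i : ℕ => if i < k then rowSum z (i + 1) - rowSum z i else 0) m,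
    ← Finset.sum_filter]
  have : (Finset.range m).filter (· < k) = Finset.range k := by
    ext i; simp; omega
  rw [this, Finset.sum_range_sub]
  simp [rowSum]

lemma sum_weight {m : ℕ} (z : TriIdx m → ℝ) : ∑ i, weight z i = rowSum z m := by
  rw [← sum_weight_lt z le_rfl]
  simp

lemma weight_withTop {n : ℕ} (lam : Fin n → ℝ) (z : LowerRows n) :
    weight (withTop lam z) = lift lam (weight z) := by
  ext i
  have := i.2
  unfold lift
  split_ifs with h
  · simp only [weight]
    rw [rowSum_withTop _ _ (by omega), rowSum_withTop _ _ (by omega)]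
  · have hi : (i : ℕ) = n - 1 := by omega
    rw [sum_weight]
    simp only [weight]
    rw [hi, rowSum_withTop _ _ le_rfl, Nat.sub_add_cancel (by omega),
      rowSum_withTop_top (by omega)]

lemma proj_lift {n : ℕ} (lam : Fin n → ℝ) (u : Fin (n - 1) → ℝ) : proj (lift lam u) = u := by
  ext j
  simp [proj, lift, j.2]

lemma lift_injective {n : ℕ} (lam : Fin n → ℝ) : Function.Injective (lift lam) :=
  Function.LeftInverse.injective (proj_lift lam)

lemma mem_pGT_iff {n : ℕ} {lam : Fin n → ℝ} {z : LowerRows n} :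
    z ∈ pGT lam ↔ IsGTPattern (withTop lam z) := by
  refine ⟨fun h => h.1, fun h => ⟨h, fun i j hi => ?_⟩⟩
  have : ¬ (i : ℕ) < n - 1 := by omega
  simp [withTop, this]

lemma mem_pGTw_lift_iff {n : ℕ} {lam : Fin n → ℝ} {z : LowerRows n} {u : Fin (n - 1) → ℝ} :
    z ∈ pGTw lam (lift lam u) ↔ z ∈ pGT lam ∧ weight z = u := by
  refine and_congr Iff.rfl ?_
  rw [← funext_iff, weight_withTop, (lift_injective lam).eq_iff]

lemma continuous_withTop {n : ℕ} (lam : Fin n → ℝ) (q : TriIdx n) :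
    Continuous fun z : LowerRows n => withTop lam z q := by
  unfold withTop
  split_ifs <;> fun_prop

lemma isClosed_pGT {n : ℕ} (lam : Fin n → ℝ) : IsClosed (pGT lam) := by
  have : pGT lam = ⋂ (i : ℕ) (h : i + 1 < n) (j : Fin (i + 1)), {z : LowerRows n |
      withTop lam z ⟨⟨i, Nat.lt_of_succ_lt h⟩, j⟩ ≤ withTop lam z ⟨⟨i + 1, h⟩, j.castSucc⟩ ∧
      withTop lam z ⟨⟨i + 1, h⟩, j.succ⟩ ≤ withTop lam z ⟨⟨i, Nat.lt_of_succ_lt h⟩, j⟩} := by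
    ext z
    simp only [mem_iInter]
    exact mem_pGT_iff
  rw [this]
  refine isClosed_iInter fun i => isClosed_iInter fun h => isClosed_iInter fun j => ?_
  exact (isClosed_le (continuous_withTop _ _) (continuous_withTop _ _)).inter
    (isClosed_le (continuous_withTop _ _) (continuous_withTop _ _))

/-- Interlacing passes the bound down from the top row; `k` counts the rows above row `i`. -/
lemma abs_le_of_mem_GT {n : ℕ} {lam : Fin n → ℝ} {x : TriIdx n → ℝ} (hx : x ∈ GT lam) {C : ℝ}
    (hC : ∀ i, |lam i| ≤ C) (k i : ℕ) (hi : i < n) (hk : i + k + 1 = n) (j : Fin (i + 1)) :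
    |x ⟨⟨i, hi⟩, j⟩| ≤ C := by
  induction k generalizing i with
  | zero =>
    rw [hx.2 ⟨i, hi⟩ j (by simpa using hk)]
    exact hC _
  | succ k ih =>
    have h := hx.1 i (by omega) j
    have h1 := ih (i + 1) (by omega) (by omega) j.castSucc
    have h2 := ih (i + 1) (by omega) (by omega) j.succ
    rw [abs_le] at h1 h2 ⊢
    exact ⟨h2.1.trans h.2, h.1.trans h1.2⟩

lemma isCompact_pGT {n : ℕ} (lam : Fin n → ℝ) : IsCompact (pGT lam) := by
  have hb : Bornology.IsBounded (WithLp.ofLp '' pGT lam) := by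
    refine (Metric.isBounded_closedBall (x := (0 : TriIdx (n - 1) → ℝ)) (r := ∑ i, |lam i|)).subset ?_
    rintro _ ⟨z, hz, rfl⟩
    rw [mem_closedBall_zero_iff, pi_norm_le_iff_of_nonneg (Finset.sum_nonneg fun _ _ => abs_nonneg _)]
    rintro ⟨i, j⟩
    have hi := i.2
    have := abs_le_of_mem_GT hz (C := ∑ i, |lam i|)
      (fun i => Finset.single_le_sum (f := fun i => |lam i|) (fun _ _ => abs_nonneg _)
        (Finset.mem_univ i)) (n - 1 - i) i (by omega) (by omega) j
    simpa [withTop, hi] using this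
  have hcl : IsClosed (WithLp.ofLp '' pGT lam) :=
    ((PiLp.homeomorph 2 (fun _ : TriIdx (n - 1) => ℝ)).isClosedMap _ (isClosed_pGT lam))
  have := (Metric.isCompact_of_isClosed_isBounded hcl hb).image
    (PiLp.continuous_toLp 2 (fun _ : TriIdx (n - 1) => ℝ))
  simpa [image_image] using this

lemma convex_pGT {n : ℕ} (lam : Fin n → ℝ) : Convex ℝ (pGT lam) := by
  intro z hz w hw a b ha hb hab
  rw [mem_pGT_iff] at hz hw ⊢
  have e : ∀ q, withTop lam (a • z + b • w) q = a * withTop lam z q + b * withTop lam w q := by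
    intro q
    unfold withTop
    split_ifs
    · simp
    · rw [← add_mul, hab, one_mul]
  intro i h j
  have h1 := hz i h j
  have h2 := hw i h j
  rw [e, e, e]
  exact ⟨add_le_add (mul_le_mul_of_nonneg_left h1.1 ha) (mul_le_mul_of_nonneg_left h2.1 hb),
    add_le_add (mul_le_mul_of_nonneg_left h1.2 ha) (mul_le_mul_of_nonneg_left h2.2 hb)⟩

/-- The strictly interlacing patterns form an open subset, which is nonempty because `lam` is
strictly decreasing. -/
lemma volume_pGT_pos {n : ℕ} {lam : Fin n → ℝ} (hlam : StrictAnti lam) : 0 < volume (pGT lam) := by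
  set U : Set (LowerRows n) := {z | ∀ (i : Fin (n - 1)) (j : Fin (i + 1)),
    withTop lam z ⟨⟨i, by omega⟩, j⟩ < withTop lam z ⟨⟨i + 1, by omega⟩, j.castSucc⟩ ∧
      withTop lam z ⟨⟨i + 1, by omega⟩, j.succ⟩ < withTop lam z ⟨⟨i, by omega⟩, j⟩} with hU
  have hUo : IsOpen U := by
    simp only [hU, ofPred_forall]
    refine isOpen_iInter_of_finite fun i => isOpen_iInter_of_finite fun j => ?_
    exact (isOpen_lt (continuous_withTop _ _) (continuous_withTop _ _)).inter
      (isOpen_lt (continuous_withTop _ _) (continuous_withTop _ _))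
  have hsub : U ⊆ pGT lam := fun z hz => mem_pGT_iff.2 fun i h j =>
    ⟨(hz ⟨i, by omega⟩ j).1.le, (hz ⟨i, by omega⟩ j).2.le⟩
  have hne : U.Nonempty := by
    -- The witness has entries $(1-\theta_i)\lambda_j+\theta_i\lambda_{j+1}$ with $\theta_i<1$
    -- strictly decreasing to 0 at the top row. The default value of `l` past the end occurs only
    -- multiplied by that zero.
    set θ : ℕ → ℝ := fun i => ((n : ℝ) - (i + 1)) / n with hθ
    set l : ℕ → ℝ := fun j => if h : j < n then lam ⟨j, h⟩ else 0 with hl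
    have hll : ∀ j, j + 1 < n → l (j + 1) < l j := fun j h => by
      simp only [hl, h, (by omega : j < n), dif_pos]
      exact hlam (Nat.lt_succ_self j)
    set x : LowerRows n := WithLp.toLp 2 fun q =>
      l q.2 - θ q.1 * (l q.2 - l (q.2 + 1)) with hx
    have hxe : ∀ q : TriIdx n, withTop lam x q = l q.2 - θ q.1 * (l q.2 - l (q.2 + 1)) := by
      rintro ⟨i, j⟩
      have hi := i.2
      have hj := j.2
      unfold withTop
      split_ifs with h
      · rfl
      · have : θ i = 0 := by
          have e : n = (i : ℕ) + 1 := by simp only at h; omega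
          have e' : (n : ℝ) = (i : ℕ) + 1 := by exact_mod_cast e
          simp only [hθ]
          rw [e']; simp
        have h2 : (j : ℕ) < n := by omega
        simp [this, hl, h2]
    refine ⟨x, fun i j => ?_⟩
    have hi := i.2
    have hj := j.2
    have hn : (0 : ℝ) < n := by exact_mod_cast (by omega : 0 < n)
    have hδ := hll j (by omega)
    have hθ1 : θ i < 1 := by
      simp only [hθ]; rw [div_lt_one hn]
      have : (0 : ℝ) ≤ (i : ℕ) := Nat.cast_nonneg _
      linarith
    have hθ2 : θ (i + 1) < θ i := by
      simp only [hθ]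
      gcongr
      linarith
    have hp : 0 ≤ θ (i + 1) * (l (j + 1) - l (j + 1 + 1)) := by
      rcases Nat.lt_or_ge ((j : ℕ) + 1 + 1) n with h | h
      · refine mul_nonneg ?_ (sub_nonneg.2 (hll _ h).le)
        simp only [hθ]
        refine div_nonneg ?_ hn.le
        have : (((i : ℕ) + 1 + 1 : ℕ) : ℝ) ≤ n := by exact_mod_cast (by omega)
        push_cast at this ⊢
        linarith
      · have e : n = (i : ℕ) + 1 + 1 := by omega
        have e' : (n : ℝ) = (i : ℕ) + 1 + 1 := by exact_mod_cast e
        have : θ (i + 1) = 0 := by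
          simp only [hθ]; rw [e']; simp
        simp [this]
    rw [hxe, hxe, hxe]
    simp only [Fin.val_castSucc, Fin.val_succ]
    constructor <;> nlinarith
  exact (hUo.measure_pos volume hne).trans_le (measure_mono hsub)

/-! ### Orthonormal coordinates adapted to the row sums -/

/-- For $m=n-1$ the count splits into the weight coordinates and the fibre dimension $(n-1)(n-2)/2$.
-/
lemma card_triIdx (m : ℕ) : Fintype.card (TriIdx m) = m + m * (m - 1) / 2 := by
  rw [Fintype.card_sigma]
  simp only [Fintype.card_fin]
  rw [Fin.sum_univ_eq_sum_range (fun i => i + 1) m, Finset.sum_add_distrib, Finset.sum_range_id]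
  simp [add_comm]

/-- The normalized indicator vector of a row. -/
noncomputable def rowVector {m : ℕ} (k : Fin m) : EuclideanSpace ℝ (TriIdx m) :=
  WithLp.toLp 2 fun q => if q.1 = k then (√((k : ℝ) + 1))⁻¹ else 0

lemma inner_rowVector {m : ℕ} (k : Fin m) (z : EuclideanSpace ℝ (TriIdx m)) :
    inner ℝ (rowVector k) z = (√((k : ℝ) + 1))⁻¹ * rowSum z (k + 1) := by
  rw [rowSum_succ _ k.2, PiLp.inner_apply, Fintype.sum_sigma, Finset.sum_eq_single k]
  · simp [rowVector, Finset.mul_sum, mul_comm]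
  · intro i _ hi
    simp [rowVector, hi]
  · simp

lemma orthonormal_rowVector (m : ℕ) : Orthonormal ℝ (rowVector (m := m)) := by
  rw [orthonormal_iff_ite]
  intro k l
  rw [inner_rowVector, rowSum_succ _ k.2]
  by_cases h : k = l
  · subst h
    have : (0 : ℝ) ≤ (k : ℝ) + 1 := by positivity
    simp only [rowVector, Fin.eta, if_true, Finset.sum_const, Finset.card_univ, Fintype.card_fin,
      nsmul_eq_mul]
    push_cast
    field_simp
    rw [Real.sq_sqrt this]
  · simp [rowVector, h]

lemma exists_rowBasis (m d : ℕ) (hd : Fintype.card (TriIdx m) = m + d) :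
    ∃ b : OrthonormalBasis (Fin m ⊕ Fin d) ℝ (EuclideanSpace ℝ (TriIdx m)),
      ∀ k, b (Sum.inl k) = rowVector k := by
  obtain ⟨b, hb⟩ := Orthonormal.exists_orthonormalBasis_extension_of_card_eq (𝕜 := ℝ)
    (E := EuclideanSpace ℝ (TriIdx m)) (ι := Fin m ⊕ Fin d) (by simp [hd])
    (v := Sum.elim rowVector fun _ => 0) (s := range Sum.inl) (by
      rw [orthonormal_iff_ite]
      rintro ⟨_, k, rfl⟩ ⟨_, l, rfl⟩
      simp only [Subtype.ext_iff, Sum.inl.injEq]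
      exact orthonormal_iff_ite.1 (orthonormal_rowVector m) k l)
  exact ⟨b, fun k => hb _ ⟨k, rfl⟩⟩

/-- An orthonormal basis of the space of triangular arrays whose first vectors are the normalized
indicators of the rows. -/
noncomputable def rowBasis (m d : ℕ) (hd : Fintype.card (TriIdx m) = m + d) :
    OrthonormalBasis (Fin m ⊕ Fin d) ℝ (EuclideanSpace ℝ (TriIdx m)) :=
  (exists_rowBasis m d hd).choose

lemma rowBasis_inl {m d : ℕ} (hd : Fintype.card (TriIdx m) = m + d) (k : Fin m) :
    rowBasis m d hd (Sum.inl k) = rowVector k :=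
  (exists_rowBasis m d hd).choose_spec k

/-- The matrix taking a weight to the normalized row sums. -/
noncomputable def rowMatrix (m : ℕ) : Matrix (Fin m) (Fin m) ℝ :=
  fun k i => if i ≤ k then (√((k : ℝ) + 1))⁻¹ else 0

/-- The matrix is lower triangular with diagonal entries $1/\sqrt{k+1}$; this is where
$\sqrt{(n-1)!}$ comes from. -/
lemma det_rowMatrix (m : ℕ) : (rowMatrix m).det = (√(m.factorial : ℝ))⁻¹ := by
  rw [Matrix.det_of_isLowerTriangular (rowMatrix m) (fun i j hij => by
    have : i < j := hij
    simp [rowMatrix, this])]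
  simp only [rowMatrix, le_refl, if_true]
  rw [Finset.prod_inv_distrib]
  congr 1
  rw [Fin.prod_univ_eq_prod_range (fun k => √((k : ℝ) + 1)) m]
  induction m with
  | zero => simp
  | succ m ih =>
    rw [Finset.prod_range_succ, ih, Nat.factorial_succ, ← Real.sqrt_mul (by positivity)]
    push_cast
    ring_nf

lemma rowMatrix_mulVec {m : ℕ} (u : Fin m → ℝ) (k : Fin m) :
    (rowMatrix m).toLin' u k =
      (√((k : ℝ) + 1))⁻¹ * ∑ i : Fin m, (if (i : ℕ) < k + 1 then u i else 0) := by
  rw [Matrix.toLin'_apply, Matrix.mulVec, dotProduct, Finset.mul_sum]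
  refine Finset.sum_congr rfl fun i _ => ?_
  have : i ≤ k ↔ (i : ℕ) < k + 1 := by rw [Fin.le_def]; omega
  by_cases h : (i : ℕ) < k + 1
  · rw [rowMatrix, if_pos (this.2 h), if_pos h]
  · rw [rowMatrix, if_neg (mt this.1 h), if_neg h, zero_mul, mul_zero]

section Coordinates

variable {m d : ℕ} (hd : Fintype.card (TriIdx m) = m + d)

/-- The array with weight `u` and further coordinates `y`. -/
noncomputable def arrayOf (p : (Fin m → ℝ) × (Fin d → ℝ)) : EuclideanSpace ℝ (TriIdx m) :=
  (rowBasis m d hd).repr.symm (WithLp.toLp 2 (Sum.elim ((rowMatrix m).toLin' p.1) p.2))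

lemma continuous_arrayOf : Continuous (arrayOf hd) := by
  refine (rowBasis m d hd).repr.symm.continuous.comp ((PiLp.continuous_toLp 2 _).comp ?_)
  refine continuous_pi fun i => ?_
  have h : Continuous (rowMatrix m).toLin' := LinearMap.continuous_of_finiteDimensional _
  rcases i with i | i
  · exact (continuous_apply i).comp (h.comp continuous_fst)
  · exact (continuous_apply i).comp continuous_snd

lemma rowSum_arrayOf (p : (Fin m → ℝ) × (Fin d → ℝ)) {k : ℕ} (hk : k ≤ m) :
    rowSum (arrayOf hd p) k = ∑ i : Fin m, (if (i : ℕ) < k then p.1 i else 0) := by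
  obtain _ | k := k
  · simp [rowSum]
  · have h : inner ℝ (rowBasis m d hd (Sum.inl ⟨k, hk⟩)) (arrayOf hd p) =
        (rowMatrix m).toLin' p.1 ⟨k, hk⟩ := by
      rw [← OrthonormalBasis.repr_apply_apply, arrayOf, LinearIsometryEquiv.apply_symm_apply]
      rfl
    rw [rowBasis_inl, inner_rowVector, rowMatrix_mulVec] at h
    have : (0 : ℝ) < √((k : ℝ) + 1) := by positivity
    exact mul_left_cancel₀ (inv_pos.2 this).ne' h

lemma weight_arrayOf (p : (Fin m → ℝ) × (Fin d → ℝ)) : weight (arrayOf hd p) = p.1 := by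
  ext i
  have hi := i.2
  rw [weight, rowSum_arrayOf hd p (by omega), rowSum_arrayOf hd p (by omega),
    ← Finset.sum_sub_distrib, Finset.sum_eq_single i]
  · simp
  · intro j _ hj
    have : (j : ℕ) ≠ i := fun h => hj (Fin.ext h)
    have h2 : (j : ℕ) < i + 1 ↔ (j : ℕ) < i := by omega
    simp [h2]
  · simp

/-- The coordinates of an array complementary to its weight. -/
noncomputable def restOf (z : EuclideanSpace ℝ (TriIdx m)) : Fin d → ℝ :=
  fun j => (rowBasis m d hd).repr z (Sum.inr j)

lemma continuous_restOf : Continuous (restOf hd) := by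
  refine continuous_pi fun j => ?_
  exact (PiLp.continuous_apply 2 _ _).comp (rowBasis m d hd).repr.continuous

lemma restOf_arrayOf (p : (Fin m → ℝ) × (Fin d → ℝ)) : restOf hd (arrayOf hd p) = p.2 := by
  ext j
  simp [restOf, arrayOf]

lemma arrayOf_weight_restOf (z : EuclideanSpace ℝ (TriIdx m)) :
    arrayOf hd (weight z, restOf hd z) = z := by
  rw [arrayOf, LinearIsometryEquiv.symm_apply_eq]
  ext i
  rcases i with k | j
  · have hk := k.2
    simp only [Sum.elim_inl]
    rw [rowMatrix_mulVec, sum_weight_lt _ (by omega), OrthonormalBasis.repr_apply_apply,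
      rowBasis_inl, inner_rowVector]
  · rfl

lemma continuous_weight : Continuous fun z : EuclideanSpace ℝ (TriIdx m) => weight z := by
  refine continuous_pi fun i => ?_
  have h : ∀ k, Continuous fun z : EuclideanSpace ℝ (TriIdx m) => rowSum z k := fun k => by
    obtain _ | k := k
    · exact continuous_const
    · by_cases hk : k < m
      · simp only [rowSum_succ _ hk]
        fun_prop
      · simp only [rowSum, hk, dif_neg, not_false_eq_true]
        fun_prop
  exact (h _).sub (h _)

/-- For fixed weight the row-sum coordinates are constant and the others are orthonormal, so
Hausdorff measure on a fibre is Lebesgue measure in `y`. -/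
lemma isometry_arrayOf (u : Fin m → ℝ) :
    Isometry fun y : EuclideanSpace ℝ (Fin d) => arrayOf hd (u, y) := by
  refine (rowBasis m d hd).repr.symm.isometry.comp (Isometry.of_dist_eq fun y y' => ?_)
  rw [EuclideanSpace.dist_eq, EuclideanSpace.dist_eq, Fintype.sum_sum_type]
  simp

/-- Coarea formula for the weight map. -/
lemma map_arrayOf_volume :
    (volume : Measure ((Fin m → ℝ) × (Fin d → ℝ))).map (arrayOf hd) =
      ENNReal.ofReal (√(m.factorial : ℝ)) • volume := by
  have hT : MeasurePreserving (fun p : (Fin m → ℝ) × (Fin d → ℝ) =>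
      (rowBasis m d hd).repr.symm (WithLp.toLp 2 ((MeasurableEquiv.sumPiEquivProdPi
        (fun _ : Fin m ⊕ Fin d => ℝ)).symm p))) :=
    (rowBasis m d hd).measurePreserving_repr_symm.comp ((PiLp.volume_preserving_toLp _).comp
      (volume_measurePreserving_sumPiEquivProdPi_symm _))
  -- All distortion of volume sits in `rowMatrix`; the remaining maps preserve measure.
  have hcomp : arrayOf hd = (fun p : (Fin m → ℝ) × (Fin d → ℝ) =>
      (rowBasis m d hd).repr.symm (WithLp.toLp 2 ((MeasurableEquiv.sumPiEquivProdPi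
        (fun _ : Fin m ⊕ Fin d => ℝ)).symm p))) ∘ Prod.map (rowMatrix m).toLin' id := by
    ext1 p
    simp only [arrayOf, Function.comp]
    congr 2
  have hL : Measurable (rowMatrix m).toLin' :=
    (LinearMap.continuous_of_finiteDimensional _).measurable
  have hf : (0 : ℝ) < √(m.factorial : ℝ) := by positivity
  have hdet : LinearMap.det (rowMatrix m).toLin' = (√(m.factorial : ℝ))⁻¹ := by
    rw [LinearMap.det_toLin', det_rowMatrix]
  rw [hcomp, ← Measure.map_map hT.measurable (hL.prodMap measurable_id), Measure.volume_eq_prod,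
    ← Measure.map_prod_map _ _ hL measurable_id, Measure.map_id,
    Measure.map_linearMap_addHaar_eq_smul_addHaar _ (by rw [hdet]; positivity), hdet, inv_inv,
    abs_of_pos hf, Measure.prod_smul_left, Measure.map_smul, ← Measure.volume_eq_prod, hT.map_eq]

end Coordinates

/-! ### The projected polytope and its lift -/

lemma isCompact_SH {n : ℕ} (lam : Fin n → ℝ) : IsCompact (SH lam) :=
  (Set.finite_range _).isCompact_convexHull ℝ

lemma continuous_proj {n : ℕ} : Continuous (proj (n := n)) :=
  continuous_pi fun _ => continuous_apply _

lemma isCompact_pSH {n : ℕ} (lam : Fin n → ℝ) : IsCompact (pSH lam) :=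
  (isCompact_SH lam).image continuous_proj

lemma continuous_lift {n : ℕ} (lam : Fin n → ℝ) : Continuous (lift lam) := by
  refine continuous_pi fun i => ?_
  unfold lift
  split_ifs <;> fun_prop

lemma measurableEmbedding_lift {n : ℕ} (lam : Fin n → ℝ) : MeasurableEmbedding (lift lam) :=
  (continuous_lift lam).measurableEmbedding (lift_injective lam)

lemma sum_eq_of_mem_SH {n : ℕ} {lam v : Fin n → ℝ} (h : v ∈ SH lam) : ∑ i, v i = ∑ i, lam i := by
  have : SH lam ⊆ {v | ∑ i, v i = ∑ i, lam i} := by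
    refine convexHull_min ?_ ?_
    · rintro _ ⟨σ, rfl⟩
      exact Equiv.sum_comp σ lam
    · intro u hu w hw a b _ _ hab
      simp only [mem_ofPred_eq] at hu hw ⊢
      simp only [Pi.add_apply, Pi.smul_apply, smul_eq_mul, Finset.sum_add_distrib,
        ← Finset.mul_sum, hu, hw]
      rw [← add_mul, hab, one_mul]
  exact this h

lemma lift_proj {n : ℕ} {lam v : Fin n → ℝ} (h : ∑ i, v i = ∑ i, lam i) :
    lift lam (proj v) = v := by
  ext i
  unfold lift
  split_ifs with hi
  · rfl
  · obtain _ | n := n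
    · exact i.elim0
    · have e : i = Fin.last n := Fin.ext (by have := i.2; simp at hi ⊢; omega)
      rw [← h, Fin.sum_univ_castSucc, e]
      exact add_sub_cancel_left _ _

/-- Every linear functional on the first `n - 1` coordinates comes from a vector in `ℝⁿ`. -/
lemma exists_dotProduct_lift_eq {n : ℕ} (lam : Fin n → ℝ) (l : (Fin (n - 1) → ℝ) →L[ℝ] ℝ) :
    ∃ x : Fin n → ℝ, ∀ u u', x ⬝ᵥ (lift lam u - lift lam u') = l (u - u') := by
  -- The last coordinate of `x` is set to 0, so the determined last coordinate of the lift plays no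
  -- role.
  refine ⟨fun i => if h : (i : ℕ) < n - 1 then l (fun j => if ⟨i, h⟩ = j then 1 else 0) else 0,
    fun u u' => ?_⟩
  obtain _ | n := n
  · have : u - u' = 0 := funext fun i => i.elim0
    simp [this, dotProduct]
  · have e : l (u - u') = ∑ i : Fin n, (u - u') i * l (fun j => if i = j then 1 else 0) :=
      LinearMap.pi_apply_eq_sum_univ l.toLinearMap (u - u')
    rw [e, dotProduct, Fin.sum_univ_castSucc]
    simp [lift, mul_comm]

/-! ### Disintegration of the pattern volume over the weight -/

section Fibres

variable {n d : ℕ} (hd : Fintype.card (TriIdx (n - 1)) = (n - 1) + d) (lam : Fin n → ℝ)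

/-- The patterns with top row `lam`, in coordinates adapted to the weight. -/
def coordGT : Set ((Fin (n - 1) → ℝ) × (Fin d → ℝ)) := arrayOf hd ⁻¹' pGT lam

lemma isCompact_coordGT : IsCompact (coordGT hd lam) := by
  have : coordGT hd lam =
      (fun z : LowerRows n => ((weight z : Fin (n - 1) → ℝ), restOf hd z)) '' pGT lam := by
    ext p
    constructor
    · intro hp
      exact ⟨arrayOf hd p, hp, Prod.ext (weight_arrayOf hd p) (restOf_arrayOf hd p)⟩
    · rintro ⟨z, hz, rfl⟩
      simpa [coordGT, arrayOf_weight_restOf] using hz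
  rw [this]
  exact (isCompact_pGT lam).image (continuous_weight.prodMk (continuous_restOf hd))

lemma convex_coordGT : Convex ℝ (coordGT hd lam) := by
  intro p hp q hq a b ha hb hab
  have := convex_pGT lam hp hq ha hb hab
  have e : arrayOf hd (a • p + b • q) = a • arrayOf hd p + b • arrayOf hd q := by
    simp only [arrayOf, ← map_smul, ← map_add]
    congr 1
    ext i
    rcases i with i | i <;> simp [Matrix.mulVec_add, Matrix.mulVec_smul]
  rwa [coordGT, mem_preimage, e]

lemma mem_pSH_of_mem_pGT {z : LowerRows n} (hz : z ∈ pGT lam) :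
    (weight z : Fin (n - 1) → ℝ) ∈ pSH lam := by
  have := weight_mem_SH hz
  rw [weight_withTop] at this
  exact ⟨_, this, proj_lift _ _⟩

lemma sliceVolume_eq_zero {u : Fin (n - 1) → ℝ} (hu : u ∉ pSH lam) :
    sliceVolume (coordGT hd lam) u = 0 := by
  have : Prod.mk u ⁻¹' coordGT hd lam = ∅ := by
    rw [eq_empty_iff_forall_notMem]
    intro y hy
    apply hu
    have := mem_pSH_of_mem_pGT lam hy
    rwa [weight_arrayOf] at this
  simp [sliceVolume, this]

lemma euclideanHausdorffMeasure_pGTw (u : Fin (n - 1) → ℝ) :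
    (Measure.euclideanHausdorffMeasure d).real (pGTw lam (lift lam u)) =
      sliceVolume (coordGT hd lam) u := by
  have h1 : pGTw lam (lift lam u) = (fun y : EuclideanSpace ℝ (Fin d) => arrayOf hd (u, y)) ''
      (WithLp.ofLp ⁻¹' (Prod.mk u ⁻¹' coordGT hd lam)) := by
    ext z
    rw [mem_pGTw_lift_iff]
    constructor
    · rintro ⟨hz, rfl⟩
      refine ⟨WithLp.toLp 2 (restOf hd z), ?_, arrayOf_weight_restOf hd z⟩
      simpa [coordGT, arrayOf_weight_restOf] using hz
    · rintro ⟨y, hy, rfl⟩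
      exact ⟨hy, weight_arrayOf _ _⟩
  rw [Measure.real, h1, (isometry_arrayOf hd u).euclideanHausdorffMeasure_image,
    EuclideanSpace.euclideanHausdorffMeasure_eq_volume, sliceVolume, Measure.real,
    (PiLp.volume_preserving_ofLp (Fin d)).measure_preimage]
  exact ((isCompact_coordGT hd lam).isClosed.preimage (by fun_prop)).measurableSet.nullMeasurableSet

/-- Fubini in the adapted coordinates, where the weight is the first component; the factor is the
Jacobian from `map_arrayOf_volume`. -/
lemma map_weight_restrict_pGT :
    ENNReal.ofReal √((n - 1).factorial : ℝ) •
      (volume.restrict (pGT lam)).map (fun z : LowerRows n => (weight z : Fin (n - 1) → ℝ)) =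
    volume.withDensity fun u => volume (Prod.mk u ⁻¹' coordGT hd lam) := by
  have hw : Measurable (fun z : LowerRows n => (weight z : Fin (n - 1) → ℝ)) :=
    continuous_weight.measurable
  ext B hB
  rw [withDensity_apply _ hB, Measure.smul_apply, Measure.map_apply hw hB,
    Measure.restrict_apply (hw hB), ← Measure.smul_apply, ← map_arrayOf_volume hd,
    Measure.map_apply (continuous_arrayOf hd).measurable
      ((hw hB).inter (isClosed_pGT lam).measurableSet), Measure.volume_eq_prod,
    Measure.prod_apply ((continuous_arrayOf hd).measurable
      ((hw hB).inter (isClosed_pGT lam).measurableSet)), ← lintegral_indicator hB]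
  refine lintegral_congr fun u => ?_
  by_cases hu : u ∈ B
  · rw [indicator_of_mem hu]
    congr 1
    ext y
    simp [weight_arrayOf, hu, coordGT]
  · rw [indicator_of_notMem hu]
    have : Prod.mk u ⁻¹' (arrayOf hd ⁻¹' ((fun z : LowerRows n =>
        (weight z : Fin (n - 1) → ℝ)) ⁻¹' B ∩ pGT lam)) = ∅ := by
      ext y
      simp [weight_arrayOf, hu]
    rw [this, measure_empty]

lemma measurable_sliceVolume : Measurable (sliceVolume (coordGT hd lam)) :=
  (measurable_measure_prodMk_left (isCompact_coordGT hd lam).isClosed.measurableSet).ennreal_toReal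

/-- Integration over Gelfand–Tsetlin patterns of a function of the weight. -/
lemma integral_pGT_weight {h : (Fin (n - 1) → ℝ) → ℝ} (hh : Continuous h) :
    √((n - 1).factorial : ℝ) * ∫ z in pGT lam, h (weight z) =
      ∫ u in pSH lam, sliceVolume (coordGT hd lam) u * h u := by
  have hw : Measurable (fun z : LowerRows n => (weight z : Fin (n - 1) → ℝ)) :=
    continuous_weight.measurable
  have hF : MeasurableSet (coordGT hd lam) := (isCompact_coordGT hd lam).isClosed.measurableSet
  rw [← integral_map (φ := fun z : LowerRows n => (weight z : Fin (n - 1) → ℝ)) hw.aemeasurable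
    hh.aestronglyMeasurable]
  have e := congrArg (fun ν => ∫ u, h u ∂ν) (map_weight_restrict_pGT hd lam)
  simp only [integral_smul_measure] at e
  rw [integral_withDensity_eq_integral_toReal_smul (measurable_measure_prodMk_left hF)
    (Filter.Eventually.of_forall fun u => (volume_slice_ne_top (isCompact_coordGT hd lam) u).lt_top),
    ENNReal.toReal_ofReal (by positivity)] at e
  rw [setIntegral_eq_integral_of_forall_compl_eq_zero]
  · exact e
  · intro u hu
    rw [sliceVolume_eq_zero hd lam hu, zero_mul]

/-- Ensures that $\log S_\lambda$ in $g$ is a genuine logarithm, so that minimality can be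
exponentiated. -/
lemma S_pos {lam : Fin n → ℝ} (hlam : StrictAnti lam) (x : Fin n → ℝ) : 0 < S lam x := by
  have hc : Continuous fun z : LowerRows n => ∑ i, weight (withTop lam z) i * x i := by
    simp only [weight_withTop]
    have := (continuous_lift lam).comp (continuous_weight (m := n - 1))
    exact continuous_finsetSum _ fun i _ => ((continuous_apply i).comp this).mul continuous_const
  have : NeZero ((volume : Measure (LowerRows n)).restrict (pGT lam)) :=
    ⟨by rw [Ne, Measure.restrict_eq_zero]; exact (volume_pGT_pos hlam).ne'⟩
  exact integral_exp_pos ((Real.continuous_exp.comp hc).continuousOn.integrableOn_compact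
    (isCompact_pGT lam))

/-- The integral of an exponential tilt of the weight distribution, centred at `mu`. -/
lemma tilt_integral_eq (mu x : Fin n → ℝ) :
    √((n - 1).factorial : ℝ) * (S lam x * Real.exp (-(x ⬝ᵥ mu))) =
      ∫ u in pSH lam, sliceVolume (coordGT hd lam) u * Real.exp (x ⬝ᵥ (lift lam u - mu)) := by
  rw [← integral_pGT_weight hd lam (h := fun u => Real.exp (x ⬝ᵥ (lift lam u - mu)))]
  · congr 1
    rw [S, ← integral_mul_const]
    refine integral_congr_ae (Filter.Eventually.of_forall fun z => ?_)
    simp only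
    rw [← Real.exp_add, weight_withTop, dotProduct_sub, sub_eq_add_neg]
    congr 2
    exact dotProduct_comm _ _
  · have := continuous_lift lam
    unfold dotProduct
    fun_prop

end Fibres

/-! ### Consequences of minimality: the mean and the lower bound -/

lemma le_of_isMin_g {n : ℕ} {lam mu xstar : Fin n → ℝ} (hlam : StrictAnti lam)
    (h : ∀ x, g lam mu xstar ≤ g lam mu x) (x : Fin n → ℝ) :
    S lam xstar * Real.exp (-(xstar ⬝ᵥ mu)) ≤ S lam x * Real.exp (-(x ⬝ᵥ mu)) := by
  have := Real.exp_le_exp.2 (h x)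
  simpa only [g, sub_eq_add_neg, Real.exp_add, Real.exp_log (S_pos hlam _)] using this

section Main

variable {n d : ℕ} (hd : Fintype.card (TriIdx (n - 1)) = (n - 1) + d) {lam mu xstar : Fin n → ℝ}

lemma exists_bound_pSH (lam : Fin n → ℝ) {h : (Fin (n - 1) → ℝ) → ℝ} (hh : Continuous h) :
    ∃ C, ∀ᵐ u ∂volume.restrict (pSH lam), |h u| ≤ C := by
  obtain ⟨C, hC⟩ := (isCompact_pSH lam).exists_bound_of_continuousOn hh.continuousOn
  refine ⟨C, ?_⟩
  filter_upwards [ae_restrict_mem (isCompact_pSH lam).measurableSet] with u hu using hC u hu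

lemma exists_bound_sliceVolume_mul (lam : Fin n → ℝ) {h : (Fin (n - 1) → ℝ) → ℝ}
    (hh : Continuous h) : ∃ C, ∀ᵐ u ∂volume.restrict (pSH lam),
      |sliceVolume (coordGT hd lam) u * h u| ≤ C := by
  obtain ⟨C, hC⟩ := exists_bound_pSH lam hh
  refine ⟨volume.real (Prod.snd '' coordGT hd lam) * C, ?_⟩
  filter_upwards [hC] with u hu
  rw [abs_mul, abs_of_nonneg (sliceVolume_nonneg _ _)]
  exact mul_le_mul (sliceVolume_le (isCompact_coordGT hd lam) u) hu (abs_nonneg _)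
    measureReal_nonneg

lemma isFiniteMeasure_restrict_pSH (lam : Fin n → ℝ) :
    IsFiniteMeasure ((volume : Measure (Fin (n - 1) → ℝ)).restrict (pSH lam)) :=
  ⟨by simpa using (isCompact_pSH lam).measure_lt_top⟩

lemma aestronglyMeasurable_sliceVolume_mul {h : (Fin (n - 1) → ℝ) → ℝ} (hh : Continuous h)
    (m : Measure (Fin (n - 1) → ℝ)) :
    AEStronglyMeasurable (fun u => sliceVolume (coordGT hd lam) u * h u) m :=
  ((measurable_sliceVolume hd lam).mul hh.measurable).aestronglyMeasurable

lemma integrable_sliceVolume_mul {h : (Fin (n - 1) → ℝ) → ℝ} (hh : Continuous h) :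
    Integrable (fun u => sliceVolume (coordGT hd lam) u * h u) (volume.restrict (pSH lam)) := by
  have := isFiniteMeasure_restrict_pSH lam
  obtain ⟨C, hC⟩ := exists_bound_sliceVolume_mul hd lam hh
  exact Integrable.of_bound (aestronglyMeasurable_sliceVolume_mul hd hh _) C hC

lemma continuous_dotProduct_lift (lam mu x : Fin n → ℝ) :
    Continuous fun u => x ⬝ᵥ (lift lam u - mu) := by
  have := continuous_lift lam
  unfold dotProduct
  fun_prop

/-- The minimality of `g` at `xstar`, expressed by tilts of the weight distribution. -/
lemma tilt_integral_le (hlam : StrictAnti lam) (h : ∀ x, g lam mu xstar ≤ g lam mu x)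
    (x : Fin n → ℝ) :
    ∫ u in pSH lam, sliceVolume (coordGT hd lam) u * Real.exp (xstar ⬝ᵥ (lift lam u - mu)) ≤
      ∫ u in pSH lam, sliceVolume (coordGT hd lam) u * Real.exp (x ⬝ᵥ (lift lam u - mu)) := by
  rw [← tilt_integral_eq, ← tilt_integral_eq]
  exact mul_le_mul_of_nonneg_left (le_of_isMin_g hlam h x) (Real.sqrt_nonneg _)

/-- The tilted weight distribution is centred at `mu` in every coordinate. -/
lemma integral_tilt_mul_sub_eq_zero (hlam : StrictAnti lam)
    (h : ∀ x, g lam mu xstar ≤ g lam mu x) (i : Fin n) :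
    ∫ u in pSH lam, sliceVolume (coordGT hd lam) u * Real.exp (xstar ⬝ᵥ (lift lam u - mu)) *
      (lift lam u i - mu i) = 0 := by
  have := isFiniteMeasure_restrict_pSH lam
  have hX : Continuous fun u => lift lam u i - mu i := by
    have := continuous_lift lam
    fun_prop
  have hE := Real.continuous_exp.comp (continuous_dotProduct_lift lam mu xstar)
  obtain ⟨C, hC⟩ := exists_bound_sliceVolume_mul hd lam hE
  obtain ⟨D, hD⟩ := exists_bound_pSH lam hX
  refine integral_mul_eq_zero_of_forall_tilt (aestronglyMeasurable_sliceVolume_mul hd hE _)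
    hX.aestronglyMeasurable hC hD fun t => ?_
  -- Perturbing `xstar` along coordinate `i` multiplies the integrand by $e^{t(v_i-\mu_i)}$.
  refine (tilt_integral_le hd hlam h (xstar + t • Pi.single i 1)).trans (le_of_eq ?_)
  refine integral_congr_ae (Filter.Eventually.of_forall fun u => ?_)
  simp only
  rw [add_dotProduct, smul_dotProduct, single_one_dotProduct, Real.exp_add, smul_eq_mul,
    mul_assoc]
  rfl

lemma f_lift (hV : ∀ u, V lam (lift lam u) = sliceVolume (coordGT hd lam) u) (x : Fin n → ℝ)
    (u : Fin (n - 1) → ℝ) :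
    f lam x (lift lam u) = sliceVolume (coordGT hd lam) u * Real.exp (x ⬝ᵥ lift lam u) := by
  rw [f, hV]

/-- Pulled back along `lift`, integrability is boundedness on a compact set, and the mean is the
centred identity after removing the constant $e^{-x^*\cdot\mu}$. -/
lemma isMeanOfDensity_f (hV : ∀ u, V lam (lift lam u) = sliceVolume (coordGT hd lam) u)
    (hlam : StrictAnti lam) (h : ∀ x, g lam mu xstar ≤ g lam mu x) :
    IsMeanOfDensity (measureSH lam) (f lam xstar) mu := by
  have hE : Continuous fun u => Real.exp (xstar ⬝ᵥ lift lam u) := by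
    simpa [Function.comp_def] using Real.continuous_exp.comp (continuous_dotProduct_lift lam 0 xstar)
  have hI := integrable_sliceVolume_mul hd (lam := lam) hE
  have hIi : ∀ i, Integrable (fun u => sliceVolume (coordGT hd lam) u *
      Real.exp (xstar ⬝ᵥ lift lam u) * lift lam u i) (volume.restrict (pSH lam)) := fun i => by
    have := integrable_sliceVolume_mul hd (lam := lam)
      (hE.mul ((continuous_apply i).comp (continuous_lift lam)))
    simpa only [mul_assoc, Pi.mul_apply, Function.comp_def] using this
  have hpos : 0 < ∫ u in pSH lam, sliceVolume (coordGT hd lam) u *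
      Real.exp (xstar ⬝ᵥ lift lam u) := by
    have := tilt_integral_eq hd lam 0 xstar
    simp only [sub_zero] at this
    rw [← this]
    have := S_pos hlam xstar
    positivity
  have hmean : ∀ i, ∫ u in pSH lam, sliceVolume (coordGT hd lam) u *
      Real.exp (xstar ⬝ᵥ lift lam u) * lift lam u i =
      (∫ u in pSH lam, sliceVolume (coordGT hd lam) u *
      Real.exp (xstar ⬝ᵥ lift lam u)) * mu i := fun i => by
    have h0 := integral_tilt_mul_sub_eq_zero hd hlam h i
    have e : ∀ u, sliceVolume (coordGT hd lam) u * Real.exp (xstar ⬝ᵥ (lift lam u - mu)) *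
        (lift lam u i - mu i) = Real.exp (-(xstar ⬝ᵥ mu)) *
        (sliceVolume (coordGT hd lam) u * Real.exp (xstar ⬝ᵥ lift lam u) * lift lam u i -
          sliceVolume (coordGT hd lam) u * Real.exp (xstar ⬝ᵥ lift lam u) * mu i) := fun u => by
      rw [dotProduct_sub, sub_eq_add_neg (xstar ⬝ᵥ lift lam u), Real.exp_add]; ring
    simp only [e] at h0
    rw [integral_const_mul, integral_sub (hIi i) (hI.mul_const _), integral_mul_const] at h0
    have := (mul_eq_zero.1 h0).resolve_left (Real.exp_pos _).ne'
    linarith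
  have hL := measurableEmbedding_lift lam
  simp only [IsMeanOfDensity, measureSH]
  rw [hL.integrable_map_iff, hL.integrable_map_iff, hL.integral_map, hL.integral_map]
  simp only [Function.comp_def, f_lift hd hV]
  refine ⟨fun v => mul_nonneg measureReal_nonneg (Real.exp_pos _).le, hI, hpos,
    Integrable.of_eval hIi, ?_⟩
  ext i
  rw [Pi.smul_apply, eval_integral (by simpa only [Pi.smul_apply, smul_eq_mul] using hIi)]
  simp only [Pi.smul_apply, smul_eq_mul]
  rw [hmean, inv_mul_cancel_left₀ hpos.ne']

/-- Every linear tilt in $u$ comes from some $x\in\mathbb R^n$, so minimality over $x$ supplies the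
hypothesis of `le_mul_volume_of_forall_tilt` at the projection of `mu`. -/
lemma le_sliceVolume_mul_volume (hmu : mu ∈ SH lam)
    (hlam : StrictAnti lam) (h : ∀ x, g lam mu xstar ≤ g lam mu x) :
    √((n - 1).factorial : ℝ) * (S lam xstar * Real.exp (-(xstar ⬝ᵥ mu))) ≤
      sliceVolume (coordGT hd lam) (proj mu) * volume.real (pSH lam) := by
  have hF := isCompact_coordGT hd lam
  refine le_mul_volume_of_forall_tilt (isCompact_pSH lam).measure_lt_top.ne (sliceVolume_nonneg _)
    (sliceVolume_le hF) (sliceVolume_logConcave hF (convex_coordGT hd lam))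
    (upperSemicontinuous_sliceVolume hF _) fun l => ?_
  obtain ⟨x, hx⟩ := exists_dotProduct_lift_eq lam l
  rw [tilt_integral_eq hd lam]
  refine (tilt_integral_le hd hlam h x).trans (le_of_eq ?_)
  simp only [← hx, lift_proj (sum_eq_of_mem_SH hmu)]

end Main

end KostkaVolume

end

theorem proposition3p5 (n : ℕ) (hn : 3 ≤ n) (lam mu : Fin n → ℝ)
    (hlam_nonneg : ∀ i, 0 ≤ lam i) (hlam : StrictAnti lam)
    (hmu_nonneg : ∀ i, 0 ≤ mu i) (hmu : mu ∈ KostkaVolume.SH lam)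
    (xstar : Fin n → ℝ)
    (hxstar : ∀ x : Fin n → ℝ, KostkaVolume.g lam mu xstar ≤ KostkaVolume.g lam mu x) :
    KostkaVolume.IsMeanOfDensity (KostkaVolume.measureSH lam) (KostkaVolume.f lam xstar) mu ∧
      Real.sqrt ((n - 1).factorial : ℝ) * KostkaVolume.S lam xstar /
          (Real.exp ((n : ℝ) + xstar ⬝ᵥ mu) * (volume (KostkaVolume.pSH lam)).toReal) ≤
        KostkaVolume.V lam mu := by
  have hd : Fintype.card (KostkaVolume.TriIdx (n - 1)) = (n - 1) + (n - 1) * (n - 2) / 2 :=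
    KostkaVolume.card_triIdx (n - 1)
  have hV : ∀ u, KostkaVolume.V lam (KostkaVolume.lift lam u) =
      sliceVolume (KostkaVolume.coordGT hd lam) u :=
    KostkaVolume.euclideanHausdorffMeasure_pGTw hd lam
  refine ⟨KostkaVolume.isMeanOfDensity_f hd hV hlam hxstar, ?_⟩
  have key := KostkaVolume.le_sliceVolume_mul_volume hd hmu hlam hxstar
  rw [← hV, KostkaVolume.lift_proj (KostkaVolume.sum_eq_of_mem_SH hmu)] at key
  have hV0 : 0 ≤ KostkaVolume.V lam mu := measureReal_nonneg
  refine div_le_of_le_mul₀ (by positivity) hV0 ?_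
  -- `key` already gives the bound without $e^n$; the factor only weakens it.
  have h1 : Real.exp (xstar ⬝ᵥ mu) ≤ Real.exp ((n : ℝ) + xstar ⬝ᵥ mu) :=
    Real.exp_le_exp.2 (le_add_of_nonneg_left (Nat.cast_nonneg n))
  calc Real.sqrt ((n - 1).factorial : ℝ) * KostkaVolume.S lam xstar
      = √((n - 1).factorial : ℝ) * (KostkaVolume.S lam xstar * Real.exp (-(xstar ⬝ᵥ mu))) *
          Real.exp (xstar ⬝ᵥ mu) := by
        rw [mul_assoc, mul_assoc, ← Real.exp_add, neg_add_cancel, Real.exp_zero, mul_one]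
    _ ≤ KostkaVolume.V lam mu * volume.real (KostkaVolume.pSH lam) *
          Real.exp ((n : ℝ) + xstar ⬝ᵥ mu) :=
        mul_le_mul key h1 (Real.exp_pos _).le (mul_nonneg hV0 measureReal_nonneg)
    _ = _ := by rw [Measure.real]; ring
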